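/- **Setting.** Fix constants $\mathcal R,c_\nu,S_0,\mathfrak q_0>0$, put $\gamma=1+\mathcal R/c_\nu$ and $A(S)=(\gamma-1)e^{(S-S_0)/c_\nu}$, and let $\phi$ be a reaction rate function. For a gas state $U=(u,v,p,\rho,Y)$, where $p=A(S)\rho^\gamma$ for some entropy value $S$ (so $p>0$ when $\rho>0$) and $Y\in[0,1]$, put $$T=\frac{p}{\mathcal R\rho},\qquad E=\frac{u^2+v^2}{2}+c_\nu T+\mathfrak q_0Y,\qquad c=\sqrt{\gamma p/\rho},\qquad M=\frac{\sqrt{u^2+v^2}}{c}.$$ The steady combustion Euler equations are $$\begin{cases}\partial_x(\rho u)+\partial_y(\rho v)=0,\\ \partial_x(\rho u^2+p)+\partial_y(\rho uv)=0,\\ \partial_x(\rho uv)+\partial_y(\rho v^2+p)=0,\\ \partial_x\big(\rho u(E+\tfrac p\rho)\big)+\partial_y\big(\rho v(E+\tfrac p\rho)\big)=0,\\ \partial_x(\rho uY)+\partial_y(\rho vY)=-\rho\,\phi(T)\,Y.\end{cases}\tag{1}$$ Let $L>0$ and let $\underline{\mathcal N}=\{(x,y):0<x<L,\ -1<y<1\}$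 be the straight nozzle. Let $\underline U_\pm=(\underline u^\pm,0,\underline p^\pm,\underline\rho^\pm,0)$ be constant states with $\underline\rho^\pm>0$, $\underline p^\pm>0$, $\underline u^\pm>\underline c^\pm=\sqrt{\gamma\underline p^\pm/\underline\rho^\pm}$ and $\underline p^+=\underline p^-$. **Theorem 1.3.** Assume that $\phi$ is $C^{1,1}$ on $T>0$ (continuously differentiable with locally Lipschitz derivative) and let $\alpha\in(0,1)$. Let $g_{cd}\in C^{2,\alpha}([0,L))$ with $g_{cd}(0)=0$ and $-1<g_{cd}(x)<1$ for $x\in[0,L)$, and put $$\mathcal N_+=\underline{\mathcal N}\cap\{y>g_{cd}(x)\},\qquad \mathcal N_-=\underline{\mathcal N}\cap\{y<g_{cd}(x)\}.$$ Let $U_\pm=(u_\pm,v_\pm,p_\pm,\rho_\pm,Y_\pm)$ have finite $C^{1,\alpha}$-norm on $\mathcal N_\pm$ (boundary values being those of the continuous extension) and be supersonic ($M>1$) solutions of (1) in $\mathcal N_\pm$ with $$u_\pm>0,\qquad u_\pm\ne c_\pm,\qquad \rho_\pm>0\qquad\text{in }\mathcal N_\pm.$$ Assume further that - $U_+=\underline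 U_+$ on $\{x=0,\ 0<y<1\}$ and $U_-=\underline U_-$ on $\{x=0,\ -1<y<0\}$; - $v_\pm=0$ on the walls $\{0<x<L,\ y=\pm1\}$; - on the curve $\{0<x<L,\ y=g_{cd}(x)\}$: $(u_+,v_+)\cdot\nu_{cd}=(u_-,v_-)\cdot\nu_{cd}=0$ and $p_+=p_-$, where $\nu_{cd}=(-g_{cd}',1)/\sqrt{1+(g_{cd}')^2}$. Then, with no smallness assumption, $$U_+=\underline U_+\ \text{ in }\mathcal N_+,\qquad U_-=\underline U_-\ \text{ in }\mathcal N_-,\qquad g_{cd}(x)=0\ \text{ for all }x\in[0,L).$$ That is, the solution is the piecewise constant background state and the contact discontinuity is the straight line $y=0$. -/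

import Mathlib

open Set

noncomputable section

namespace CombustionNozzle

/-! ## The gas -/

/-- Constants and reaction rate of an ideal polytropic reacting gas: gas constant `R`, specific
heat `cv`, reference entropy `S0`, binding energy `q0`, reaction rate `φ` (a function of the
temperature). -/
structure Gas where
  R : ℝ
  cv : ℝ
  S0 : ℝ
  q0 : ℝ
  φ : ℝ → ℝ
  R_pos : 0 < R
  cv_pos : 0 < cv
  S0_pos : 0 < S0
  q0_pos : 0 < q0

/-- The adiabatic exponent `γ = 1 + R / c_ν`. -/
def Gas.γ (G : Gas) : ℝ := 1 + G.R / G.cv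

/-- `A(S) = (γ - 1) exp((S - S₀) / c_ν)`. -/
def Gas.A (G : Gas) (S : ℝ) : ℝ := (G.γ - 1) * Real.exp ((S - G.S0) / G.cv)

/-- The state `(u, v, p, ρ, Y)`: velocity, pressure, density, mass fraction of unburned gas. -/
@[ext] structure FlowState where
  u : ℝ
  v : ℝ
  p : ℝ
  ρ : ℝ
  Y : ℝ

/-- The law of state `p = A(S) ρ^γ` for some value `S` of the entropy. -/
def Gas.StateLaw (G : Gas) (U : FlowState) : Prop :=
  ∃ S : ℝ, U.p = G.A S * U.ρ ^ G.γ

/-- The temperature `T = p / (R ρ)`. -/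
def Gas.temp (G : Gas) (U : FlowState) : ℝ := U.p / (G.R * U.ρ)

/-- The total energy `E = (u² + v²)/2 + e + q₀ Y` with internal energy `e = c_ν T`. -/
def Gas.energy (G : Gas) (U : FlowState) : ℝ :=
  (U.u ^ 2 + U.v ^ 2) / 2 + G.cv * G.temp U + G.q0 * U.Y

/-- The sonic speed `c = √(γ p / ρ)`. -/
def Gas.sonic (G : Gas) (U : FlowState) : ℝ := Real.sqrt (G.γ * U.p / U.ρ)

/-- The Mach number `M = √(u² + v²) / c`. -/
def Gas.mach (G : Gas) (U : FlowState) : ℝ := Real.sqrt (U.u ^ 2 + U.v ^ 2) / G.sonic U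

/-- For positive density, the law of state just says that the pressure is positive. -/
theorem Gas.stateLaw_iff (G : Gas) (U : FlowState) (h : 0 < U.ρ) : G.StateLaw U ↔ 0 < U.p := by
  have hg : 0 < G.γ - 1 := by
    have := div_pos G.R_pos G.cv_pos
    simp only [Gas.γ]; linarith
  have hr : 0 < U.ρ ^ G.γ := Real.rpow_pos_of_pos h _
  constructor
  · rintro ⟨S, hS⟩
    rw [hS, Gas.A]
    positivity
  · intro hp
    refine ⟨G.S0 + G.cv * Real.log (U.p / ((G.γ - 1) * U.ρ ^ G.γ)), ?_⟩
    have hc := G.cv_pos.ne'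
    rw [Gas.A, add_sub_cancel_left, mul_div_cancel_left₀ _ hc, Real.exp_log (by positivity)]
    field_simp

/-! ## Function spaces -/

/-- `φ` is `C^{1,1}` on `T > 0`: continuously differentiable with locally Lipschitz derivative. -/
def IsC11 (φ : ℝ → ℝ) : Prop :=
  ContDiffOn ℝ 1 φ (Ioi 0) ∧ LocallyLipschitzOn (Ioi 0) (deriv φ)

/-- `∂_x F` at `z = (x, y)`. -/
def dx (F : ℝ × ℝ → ℝ) (z : ℝ × ℝ) : ℝ := deriv (fun s => F (s, z.2)) z.1

/-- `∂_y F` at `z = (x, y)`. -/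
def dy (F : ℝ × ℝ → ℝ) (z : ℝ × ℝ) : ℝ := deriv (fun s => F (z.1, s)) z.2

/-- The Euclidean distance in the plane. -/
def euclDist (z w : ℝ × ℝ) : ℝ := Real.sqrt ((z.1 - w.1) ^ 2 + (z.2 - w.2) ^ 2)

/-- `f ∈ C^{1,α}(Ω)` for an open set `Ω` of the plane: `f` is `C¹` in `Ω` and its
`C^{1,α}`-norm over `Ω` is finite. -/
def IsC1Alpha (α : ℝ) (Ω : Set (ℝ × ℝ)) (f : ℝ × ℝ → ℝ) : Prop :=
  ContDiffOn ℝ 1 f Ω ∧ ∃ C : ℝ,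
    (∀ z ∈ Ω, |f z| ≤ C ∧ |dx f z| ≤ C ∧ |dy f z| ≤ C) ∧
    (∀ z ∈ Ω, ∀ w ∈ Ω, |dx f z - dx f w| ≤ C * euclDist z w ^ α ∧
      |dy f z - dy f w| ≤ C * euclDist z w ^ α)

/-- `g ∈ C^{2,α}([0, L))`: `g` is `C²` on `[0, L)` (one-sided at `0`) and its `C^{2,α}`-norm over
`[0, L)` is finite. -/
def IsC2Alpha (α L : ℝ) (g : ℝ → ℝ) : Prop :=
  ContDiffOn ℝ 2 g (Ico 0 L) ∧ ∃ C : ℝ,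
    (∀ k ≤ 2, ∀ x ∈ Ico 0 L, |iteratedDerivWithin k g (Ico 0 L) x| ≤ C) ∧
    (∀ x ∈ Ico 0 L, ∀ y ∈ Ico 0 L,
      |iteratedDerivWithin 2 g (Ico 0 L) x - iteratedDerivWithin 2 g (Ico 0 L) y|
        ≤ C * |x - y| ^ α)

/-- All five components of the flow are in `C^{1,α}(Ω)`. -/
def IsC1AlphaFlow (α : ℝ) (Ω : Set (ℝ × ℝ)) (U : ℝ × ℝ → FlowState) : Prop :=
  IsC1Alpha α Ω (fun z => (U z).u) ∧ IsC1Alpha α Ω (fun z => (U z).v) ∧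
  IsC1Alpha α Ω (fun z => (U z).p) ∧ IsC1Alpha α Ω (fun z => (U z).ρ) ∧
  IsC1Alpha α Ω (fun z => (U z).Y)

/-- All five components of the flow are continuous on `K`. -/
def ContinuousFlowOn (U : ℝ × ℝ → FlowState) (K : Set (ℝ × ℝ)) : Prop :=
  ContinuousOn (fun z => (U z).u) K ∧ ContinuousOn (fun z => (U z).v) K ∧
  ContinuousOn (fun z => (U z).p) K ∧ ContinuousOn (fun z => (U z).ρ) K ∧
  ContinuousOn (fun z => (U z).Y) K

/-! ## The free boundary problem -/

/-- The steady combustion Euler equations at the point `z`. -/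
def Gas.EulerAt (G : Gas) (U : ℝ × ℝ → FlowState) (z : ℝ × ℝ) : Prop :=
  dx (fun w => (U w).ρ * (U w).u) z + dy (fun w => (U w).ρ * (U w).v) z = 0 ∧
  dx (fun w => (U w).ρ * (U w).u ^ 2 + (U w).p) z
    + dy (fun w => (U w).ρ * (U w).u * (U w).v) z = 0 ∧
  dx (fun w => (U w).ρ * (U w).u * (U w).v) z
    + dy (fun w => (U w).ρ * (U w).v ^ 2 + (U w).p) z = 0 ∧
  dx (fun w => (U w).ρ * (U w).u * (G.energy (U w) + (U w).p / (U w).ρ)) z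
    + dy (fun w => (U w).ρ * (U w).v * (G.energy (U w) + (U w).p / (U w).ρ)) z = 0 ∧
  dx (fun w => (U w).ρ * (U w).u * (U w).Y) z + dy (fun w => (U w).ρ * (U w).v * (U w).Y) z
    = -((U z).ρ * G.φ (G.temp (U z)) * (U z).Y)

/-- `{0 < x < L, f(x) < y < g(x)}`. -/
def region (L : ℝ) (f g : ℝ → ℝ) : Set (ℝ × ℝ) :=
  {z | 0 < z.1 ∧ z.1 < L ∧ f z.1 < z.2 ∧ z.2 < g z.1}

/-- `{0 ≤ x < L, f(x) ≤ y ≤ g(x)}`: the region with its entrance and lateral boundaries. -/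
def regionWithBoundary (L : ℝ) (f g : ℝ → ℝ) : Set (ℝ × ℝ) :=
  {z | 0 ≤ z.1 ∧ z.1 < L ∧ f z.1 ≤ z.2 ∧ z.2 ≤ g z.1}

/-- The velocity component `(u, v) · ν` of `U`, where `ν = (-m, 1) / √(1 + m²)` is a unit normal
vector to a curve of slope `m`. -/
def normalVelocity (U : FlowState) (m : ℝ) : ℝ :=
  (U.u * (-m) + U.v * 1) / Real.sqrt (1 + m ^ 2)

/-- A supersonic `C^{1,α}` solution of the combustion Euler equations in the layer
`{0 < x < L, f(x) < y < g(x)}`. A function in `C^{1,α}` of the layer extends continuously to the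
entrance and to the lateral boundaries, and `U` is this extension there (its boundary values are
its traces). -/
structure Gas.IsLayerFlow (G : Gas) (α L : ℝ) (f g : ℝ → ℝ) (U : ℝ × ℝ → FlowState) :
    Prop where
  smooth : IsC1AlphaFlow α (region L f g) U
  trace : ContinuousFlowOn U (regionWithBoundary L f g)
  stateLaw : ∀ z ∈ region L f g, G.StateLaw (U z)
  fraction : ∀ z ∈ region L f g, (U z).Y ∈ Icc (0 : ℝ) 1
  supersonic : ∀ z ∈ region L f g, 1 < G.mach (U z)
  euler : ∀ z ∈ region L f g, G.EulerAt U z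

/-- `(Um, Up, gcd)` is a piecewise `C^{1,α}` supersonic contact discontinuity solution in the
nozzle `{0 < x < L, gm(x) < y < gp(x)}` with entrance data `Uinm` (below) and `Uinp` (above):
the curve `y = gcd(x)` issues from the origin and separates two supersonic layers, the flows take
the entrance data, slip along the walls, and satisfy the Rankine-Hugoniot conditions of a contact
discontinuity on `y = gcd(x)`. -/
structure Gas.IsContactSolution (G : Gas) (α L : ℝ) (gm gp : ℝ → ℝ) (Uinm Uinp : ℝ → FlowState)
    (Um Up : ℝ × ℝ → FlowState) (gcd : ℝ → ℝ) : Prop where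
  gcd_zero : gcd 0 = 0
  gcd_mem : ∀ x ∈ Ico 0 L, gcd x ∈ Ioo (gm x) (gp x)
  upper : G.IsLayerFlow α L gcd gp Up
  lower : G.IsLayerFlow α L gm gcd Um
  upper_inlet : ∀ y ∈ Ioo 0 (gp 0), Up (0, y) = Uinp y
  lower_inlet : ∀ y ∈ Ioo (gm 0) 0, Um (0, y) = Uinm y
  upper_wall : ∀ x ∈ Ioo 0 L, normalVelocity (Up (x, gp x)) (deriv gp x) = 0
  lower_wall : ∀ x ∈ Ioo 0 L, normalVelocity (Um (x, gm x)) (deriv gm x) = 0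
  contact_upper : ∀ x ∈ Ioo 0 L, normalVelocity (Up (x, gcd x)) (deriv gcd x) = 0
  contact_lower : ∀ x ∈ Ioo 0 L, normalVelocity (Um (x, gcd x)) (deriv gcd x) = 0
  contact_pressure : ∀ x ∈ Ioo 0 L, (Up (x, gcd x)).p = (Um (x, gcd x)).p

/-- On a straight wall the slip condition reads `v = 0`. -/
theorem normalVelocity_straight (U : FlowState) (a x : ℝ) :
    normalVelocity U (deriv (fun _ : ℝ => a) x) = 0 ↔ U.v = 0 := by
  simp [normalVelocity]

/-- The constant state `(u, 0, p, ρ, 0)`. -/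
def uniformState (u p ρ : ℝ) : FlowState := ⟨u, 0, p, ρ, 0⟩

end CombustionNozzle

end

open Set

noncomputable section

namespace CombustionNozzle

/-! ## Bounded `C¹` functions in the plane -/

/-! Where the flow is supersonic in the direction of x, the Euler system is hyperbolic with x as
time, and uniqueness follows from an energy estimate. Let W = (ū, 0, p̄, ρ̄, 0) be the background
state of a layer, H the total enthalpy and H̄ its value at W. `relEnergy` is a quadratic form in u -
ū, v, p - p̄, Y and H - H̄ whose coefficients depend on the solution. For positive p, ρ and u, its
part in (u - ū, p - p̄) is positive definite exactly when u > c. It then vanishes only at W, since H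
and p determine ρ once u, v and Y are known.

Multiply the momentum equations by u - ū and v, the pressure equation by (p - p̄) / (γp), and the
transport equations of H and Y by 2(H - H̄) and 2Y. The sum (`relEnergy_balance`) shows that the
divergence of (`relEnergy`, `relFlux`) involves only Y(p - p̄), Y² and (p - p̄)². Their coefficients
are bounded because the first derivatives of the flow are, so the production is at most a multiple
of the energy. Only a bound for |φ| enters, not its sign.

Through a slip curve of slope m the flux is m ū (p - p̄) (`relFlux_sub_of_slip`). It vanishes on the
flat walls. On the contact curve p and p̄ are common to both layers, so the two contributions cancel
once the energy of each layer is divided by its own ū. The weighted sum E of the two energies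
satisfies E' ≤ K E, and Gronwall gives E = 0.

No smallness is needed because the estimate always starts from a section on which the flow already
equals the background. Continuity and compactness then give u > c, with uniform bounds, on a strip
to the right; the energy estimate makes that strip uniform; and uniformity of sections passes to
limits. Finally v = 0 and u > 0 in the slip condition force the contact curve to have slope zero. -/

theorem hasDerivAt_dx {f : ℝ × ℝ → ℝ} {z : ℝ × ℝ} (h : DifferentiableAt ℝ f z) :
    HasDerivAt (fun s => f (s, z.2)) (dx f z) z.1 := by
  have : HasFDerivAt f (fderiv ℝ f z) ((fun s : ℝ => (s, z.2)) z.1) := h.hasFDerivAt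
  exact (this.comp_hasDerivAt z.1
    ((hasDerivAt_id z.1).prodMk (hasDerivAt_const z.1 z.2))).differentiableAt.hasDerivAt

theorem hasDerivAt_dy {f : ℝ × ℝ → ℝ} {z : ℝ × ℝ} (h : DifferentiableAt ℝ f z) :
    HasDerivAt (fun s => f (z.1, s)) (dy f z) z.2 := by
  have : HasFDerivAt f (fderiv ℝ f z) ((fun s : ℝ => (z.1, s)) z.2) := h.hasFDerivAt
  exact (this.comp_hasDerivAt z.2
    ((hasDerivAt_const z.2 z.1).prodMk (hasDerivAt_id z.2))).differentiableAt.hasDerivAt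

theorem fderiv_apply_eq {f : ℝ × ℝ → ℝ} {z : ℝ × ℝ} (h : DifferentiableAt ℝ f z) (a b : ℝ) :
    fderiv ℝ f z (a, b) = a * dx f z + b * dy f z := by
  have h1 : dx f z = fderiv ℝ f z (1, 0) := by
    have : HasFDerivAt f (fderiv ℝ f z) ((fun s : ℝ => (s, z.2)) z.1) := h.hasFDerivAt
    exact (this.comp_hasDerivAt z.1
      ((hasDerivAt_id z.1).prodMk (hasDerivAt_const z.1 z.2))).deriv
  have h2 : dy f z = fderiv ℝ f z (0, 1) := by
    have : HasFDerivAt f (fderiv ℝ f z) ((fun s : ℝ => (z.1, s)) z.2) := h.hasFDerivAt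
    exact (this.comp_hasDerivAt z.2
      ((hasDerivAt_const z.2 z.1).prodMk (hasDerivAt_id z.2))).deriv
  have h3 : ((a, b) : ℝ × ℝ) = a • (1, 0) + b • (0, 1) := by simp
  rw [h3, map_add, map_smul, map_smul, h1, h2]
  simp

/-- `f` is `C¹` in `Ω`, bounded together with its first derivatives. -/
def IsC1Bdd (Ω : Set (ℝ × ℝ)) (f : ℝ × ℝ → ℝ) : Prop :=
  ContDiffOn ℝ 1 f Ω ∧ ∃ C : ℝ, ∀ z ∈ Ω, |f z| ≤ C ∧ |dx f z| ≤ C ∧ |dy f z| ≤ C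

namespace IsC1Bdd

variable {Ω Ω' : Set (ℝ × ℝ)} {f g : ℝ × ℝ → ℝ} {z : ℝ × ℝ}

theorem differentiableAt (hf : IsC1Bdd Ω f) (hΩ : IsOpen Ω) (hz : z ∈ Ω) :
    DifferentiableAt ℝ f z :=
  (hf.1.differentiableOn one_ne_zero).differentiableAt (hΩ.mem_nhds hz)

theorem mono (hf : IsC1Bdd Ω f) (h : Ω' ⊆ Ω) : IsC1Bdd Ω' f :=
  ⟨hf.1.mono h, hf.2.imp fun _ hC z hz => hC z (h hz)⟩

theorem continuousOn_dx (hf : IsC1Bdd Ω f) (hΩ : IsOpen Ω) : ContinuousOn (dx f) Ω := by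
  have h := (hf.1.continuousOn_fderiv_of_isOpen hΩ le_rfl).clm_apply
    (continuousOn_const (c := ((1, 0) : ℝ × ℝ)))
  refine h.congr fun z hz => ?_
  simp [fderiv_apply_eq (hf.differentiableAt hΩ hz)]

theorem continuousOn_dy (hf : IsC1Bdd Ω f) (hΩ : IsOpen Ω) : ContinuousOn (dy f) Ω := by
  have h := (hf.1.continuousOn_fderiv_of_isOpen hΩ le_rfl).clm_apply
    (continuousOn_const (c := ((0, 1) : ℝ × ℝ)))
  refine h.congr fun z hz => ?_
  simp [fderiv_apply_eq (hf.differentiableAt hΩ hz)]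

theorem const (c : ℝ) : IsC1Bdd Ω (fun _ => c) :=
  ⟨contDiffOn_const, |c|, fun z _ => by simp [dx, dy]⟩

theorem add (hf : IsC1Bdd Ω f) (hg : IsC1Bdd Ω g) (hΩ : IsOpen Ω) :
    IsC1Bdd Ω (fun z => f z + g z) := by
  obtain ⟨C, hC⟩ := hf.2
  obtain ⟨D, hD⟩ := hg.2
  refine ⟨hf.1.add hg.1, C + D, fun z hz => ?_⟩
  have hfz := hf.differentiableAt hΩ hz
  have hgz := hg.differentiableAt hΩ hz
  have h1 : dx (fun z => f z + g z) z = dx f z + dx g z :=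
    ((hasDerivAt_dx hfz).add (hasDerivAt_dx hgz)).deriv
  have h2 : dy (fun z => f z + g z) z = dy f z + dy g z :=
    ((hasDerivAt_dy hfz).add (hasDerivAt_dy hgz)).deriv
  rw [h1, h2]
  obtain ⟨a1, a2, a3⟩ := hC z hz
  obtain ⟨b1, b2, b3⟩ := hD z hz
  exact ⟨(abs_add_le _ _).trans (by linarith), (abs_add_le _ _).trans (by linarith),
    (abs_add_le _ _).trans (by linarith)⟩

theorem mul (hf : IsC1Bdd Ω f) (hg : IsC1Bdd Ω g) (hΩ : IsOpen Ω) :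
    IsC1Bdd Ω (fun z => f z * g z) := by
  obtain ⟨C, hC⟩ := hf.2
  obtain ⟨D, hD⟩ := hg.2
  refine ⟨hf.1.mul hg.1, C * D + C * D, fun z hz => ?_⟩
  have hfz := hf.differentiableAt hΩ hz
  have hgz := hg.differentiableAt hΩ hz
  have h1 : dx (fun z => f z * g z) z = dx f z * g z + f z * dx g z :=
    ((hasDerivAt_dx hfz).mul (hasDerivAt_dx hgz)).deriv
  have h2 : dy (fun z => f z * g z) z = dy f z * g z + f z * dy g z :=
    ((hasDerivAt_dy hfz).mul (hasDerivAt_dy hgz)).deriv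
  rw [h1, h2]
  obtain ⟨a1, a2, a3⟩ := hC z hz
  obtain ⟨b1, b2, b3⟩ := hD z hz
  have hC0 : 0 ≤ C := (abs_nonneg _).trans a1
  have key : ∀ a b : ℝ, |a| ≤ C → |b| ≤ D → |a * b| ≤ C * D := fun a b ha hb => by
    rw [abs_mul]
    exact mul_le_mul ha hb (abs_nonneg _) hC0
  have hCD : 0 ≤ C * D := (abs_nonneg _).trans (key _ _ a1 b1)
  exact ⟨(key _ _ a1 b1).trans (by linarith),
    (abs_add_le _ _).trans (add_le_add (key _ _ a2 b1) (key _ _ a1 b2)),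
    (abs_add_le _ _).trans (add_le_add (key _ _ a3 b1) (key _ _ a1 b3))⟩

theorem sub (hf : IsC1Bdd Ω f) (hg : IsC1Bdd Ω g) (hΩ : IsOpen Ω) :
    IsC1Bdd Ω (fun z => f z - g z) := by
  have h := hf.add ((IsC1Bdd.const (-1)).mul hg hΩ) hΩ
  simpa [sub_eq_add_neg] using h

theorem sq (hf : IsC1Bdd Ω f) (hΩ : IsOpen Ω) : IsC1Bdd Ω (fun z => f z ^ 2) := by
  simpa [pow_two] using hf.mul hf hΩ

/-- A uniform lower bound, rather than positivity alone, is what keeps the reciprocal and its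
derivatives bounded up to the boundary of Ω. -/
theorem inv (hf : IsC1Bdd Ω f) (hΩ : IsOpen Ω) {m : ℝ} (hm : 0 < m) (h : ∀ z ∈ Ω, m ≤ f z) :
    IsC1Bdd Ω (fun z => (f z)⁻¹) := by
  obtain ⟨C, hC⟩ := hf.2
  refine ⟨hf.1.inv fun z hz => (hm.trans_le (h z hz)).ne', m⁻¹ + C * (m ^ 2)⁻¹, fun z hz => ?_⟩
  have hfz := hf.differentiableAt hΩ hz
  have h0 : 0 < f z := hm.trans_le (h z hz)
  have h1 : dx (fun z => (f z)⁻¹) z = -dx f z / f z ^ 2 :=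
    ((hasDerivAt_dx hfz).fun_inv h0.ne').deriv
  have h2 : dy (fun z => (f z)⁻¹) z = -dy f z / f z ^ 2 :=
    ((hasDerivAt_dy hfz).fun_inv h0.ne').deriv
  rw [h1, h2]
  obtain ⟨a1, a2, a3⟩ := hC z hz
  have hC0 : 0 ≤ C := (abs_nonneg _).trans a1
  have hm' : 0 < m⁻¹ := inv_pos.2 hm
  have hi : (f z ^ 2)⁻¹ ≤ (m ^ 2)⁻¹ := by
    gcongr
    exact h z hz
  have key : ∀ a : ℝ, |a| ≤ C → |-a / f z ^ 2| ≤ m⁻¹ + C * (m ^ 2)⁻¹ := fun a ha => by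
    rw [div_eq_mul_inv, abs_mul, abs_neg, abs_of_pos (inv_pos.2 (pow_pos h0 2))]
    have := mul_le_mul ha hi (inv_pos.2 (pow_pos h0 2)).le hC0
    linarith
  refine ⟨?_, key _ a2, key _ a3⟩
  rw [abs_of_pos (inv_pos.2 h0)]
  have h3 : (f z)⁻¹ ≤ m⁻¹ := inv_anti₀ hm (h z hz)
  have h4 : 0 ≤ C * (m ^ 2)⁻¹ := by positivity
  linarith

theorem div (hf : IsC1Bdd Ω f) (hg : IsC1Bdd Ω g) (hΩ : IsOpen Ω) {m : ℝ} (hm : 0 < m)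
    (h : ∀ z ∈ Ω, m ≤ g z) : IsC1Bdd Ω (fun z => f z / g z) := by
  simpa [div_eq_mul_inv] using hf.mul (hg.inv hΩ hm h) hΩ

end IsC1Bdd

theorem IsC1Alpha.isC1Bdd {α : ℝ} {Ω : Set (ℝ × ℝ)} {f : ℝ × ℝ → ℝ} (h : IsC1Alpha α Ω f) :
    IsC1Bdd Ω f :=
  ⟨h.1, h.2.imp fun _ hC => hC.1⟩

/-! ## Integration over moving sections -/

/-- `{a < x < b, f(x) < y < g(x)}`. -/
def strip (a b : ℝ) (f g : ℝ → ℝ) : Set (ℝ × ℝ) :=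
  {z | a < z.1 ∧ z.1 < b ∧ f z.1 < z.2 ∧ z.2 < g z.1}

/-- `{a ≤ x < b, f(x) ≤ y ≤ g(x)}`. -/
def closedStrip (a b : ℝ) (f g : ℝ → ℝ) : Set (ℝ × ℝ) :=
  {z | a ≤ z.1 ∧ z.1 < b ∧ f z.1 ≤ z.2 ∧ z.2 ≤ g z.1}

/-- A continuous curve over `[a, b)`, differentiable over `(a, b)` with bounded slope. -/
structure IsCurve (a b : ℝ) (f : ℝ → ℝ) : Prop where
  cont : ContinuousOn f (Ico a b)
  diff : ∀ x ∈ Ioo a b, DifferentiableAt ℝ f x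
  slope : ∃ C : ℝ, ∀ x ∈ Ioo a b, |deriv f x| ≤ C

theorem IsCurve.mono {a b a' b' : ℝ} {f : ℝ → ℝ} (h : IsCurve a b f) (ha : a ≤ a') (hb : b' ≤ b) :
    IsCurve a' b' f where
  cont := h.cont.mono (Ico_subset_Ico ha hb)
  diff := fun x hx => h.diff x (Ioo_subset_Ioo ha hb hx)
  slope := h.slope.imp fun _ hC x hx => hC x (Ioo_subset_Ioo ha hb hx)

theorem strip_subset_closedStrip (a b : ℝ) (f g : ℝ → ℝ) : strip a b f g ⊆ closedStrip a b f g :=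
  fun _ h => ⟨h.1.le, h.2.1, h.2.2.1.le, h.2.2.2.le⟩

theorem isOpen_strip {a b : ℝ} {f g : ℝ → ℝ} (hf : ContinuousOn f (Ico a b))
    (hg : ContinuousOn g (Ico a b)) : IsOpen (strip a b f g) := by
  rw [isOpen_iff_mem_nhds]
  rintro z ⟨h1, h2, h3, h4⟩
  have hI : Ico a b ∈ nhds z.1 := Ico_mem_nhds h1 h2
  have hfz : ContinuousAt (fun w : ℝ × ℝ => f w.1) z := by
    have := hf.continuousAt hI
    exact ContinuousAt.comp (f := Prod.fst) this continuousAt_fst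
  have hgz : ContinuousAt (fun w : ℝ × ℝ => g w.1) z := by
    have := hg.continuousAt hI
    exact ContinuousAt.comp (f := Prod.fst) this continuousAt_fst
  filter_upwards [continuousAt_fst.eventually (lt_mem_nhds h1),
    continuousAt_fst.eventually (gt_mem_nhds h2), hfz.eventually_lt continuousAt_snd h3,
    continuousAt_snd.eventually_lt hgz h4] with w a1 a2 a3 a4
  exact ⟨a1, a2, a3, a4⟩

/-- The point of height `s ∈ [0, 1]` between the curves `f` and `g` over `x`. -/
def level (f g : ℝ → ℝ) (x s : ℝ) : ℝ := f x + s * (g x - f x)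

section Level

variable {a b x s : ℝ} {f g : ℝ → ℝ}

theorem level_zero : level f g x 0 = f x := by simp [level]

theorem level_one : level f g x 1 = g x := by simp [level]

theorem level_mem_closedStrip (hx : x ∈ Ico a b) (h : f x < g x) (hs : s ∈ Icc (0 : ℝ) 1) :
    (x, level f g x s) ∈ closedStrip a b f g := by
  refine ⟨hx.1, hx.2, ?_, ?_⟩ <;> simp only [level] <;> nlinarith [hs.1, hs.2]

theorem level_mem_strip (hx : x ∈ Ioo a b) (h : f x < g x) (hs : s ∈ Ioo (0 : ℝ) 1) :
    (x, level f g x s) ∈ strip a b f g := by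
  refine ⟨hx.1, hx.2, ?_, ?_⟩ <;> simp only [level] <;> nlinarith [hs.1, hs.2]

theorem exists_level_eq {y : ℝ} (h : f x < g x) (hy : y ∈ Icc (f x) (g x)) :
    ∃ s ∈ Icc (0 : ℝ) 1, level f g x s = y := by
  have h0 : 0 < g x - f x := sub_pos.2 h
  refine ⟨(y - f x) / (g x - f x), ⟨div_nonneg (by linarith [hy.1]) h0.le, ?_⟩, ?_⟩
  · rw [div_le_one h0]
    linarith [hy.2]
  · rw [level, div_mul_cancel₀ _ h0.ne']
    ring

theorem hasDerivAt_level_right : HasDerivAt (fun s => level f g x s) (g x - f x) s := by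
  have := ((hasDerivAt_id s).mul_const (g x - f x)).const_add (f x)
  simpa [level] using this

theorem hasDerivAt_level_left (hf : DifferentiableAt ℝ f x) (hg : DifferentiableAt ℝ g x) :
    HasDerivAt (fun x => level f g x s) (level (deriv f) (deriv g) x s) x :=
  hf.hasDerivAt.add ((hg.hasDerivAt.sub hf.hasDerivAt).const_mul s)

theorem continuousOn_level (hf : ContinuousOn f (Ico a b)) (hg : ContinuousOn g (Ico a b)) :
    ContinuousOn (fun z : ℝ × ℝ => (z.1, level f g z.1 z.2)) (Ico a b ×ˢ Icc 0 1) := by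
  have h1 : ContinuousOn (fun z : ℝ × ℝ => f z.1) (Ico a b ×ˢ Icc (0 : ℝ) 1) :=
    hf.comp continuousOn_fst fun z hz => hz.1
  have h2 : ContinuousOn (fun z : ℝ × ℝ => g z.1) (Ico a b ×ˢ Icc (0 : ℝ) 1) :=
    hg.comp continuousOn_fst fun z hz => hz.1
  exact continuousOn_fst.prodMk (h1.add (continuousOn_snd.mul (h2.sub h1)))

end Level

/-- The integral of `Q` over the section `{x} × (f(x), g(x))`, in the coordinate `level`. -/
def sectionIntegral (f g : ℝ → ℝ) (Q : ℝ × ℝ → ℝ) (x : ℝ) : ℝ :=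
  ∫ s in (0 : ℝ)..1, (g x - f x) * Q (x, level f g x s)

section Sections

open MeasureTheory

variable {a b : ℝ} {f g : ℝ → ℝ} {Q F : ℝ × ℝ → ℝ}

theorem continuousOn_section {x : ℝ} (hx : x ∈ Ico a b) (h : f x < g x)
    (hQ : ContinuousOn Q (closedStrip a b f g)) :
    ContinuousOn (fun s => Q (x, level f g x s)) (Icc 0 1) := by
  refine hQ.comp ?_ fun s hs => level_mem_closedStrip hx h hs
  unfold level
  fun_prop

theorem continuousOn_sectionIntegral (hf : ContinuousOn f (Ico a b)) (hg : ContinuousOn g (Ico a b))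
    (hfg : ∀ x ∈ Ico a b, f x < g x) (hQ : ContinuousOn Q (closedStrip a b f g)) :
    ContinuousOn (sectionIntegral f g Q) (Ico a b) := by
  have h : ContinuousOn (fun z : ℝ × ℝ => (g z.1 - f z.1) * Q (z.1, level f g z.1 z.2))
      (Ico a b ×ˢ Icc 0 1) := by
    refine ContinuousOn.mul ?_ ?_
    · exact (hg.comp continuousOn_fst fun z hz => hz.1).sub
        (hf.comp continuousOn_fst fun z hz => hz.1)
    · exact hQ.comp (continuousOn_level hf hg) fun z hz =>
        level_mem_closedStrip hz.1 (hfg _ hz.1) hz.2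
  -- The theorem on parametric integrals asks for an integrand continuous for all real s. Clamping s
  -- to [0, 1] with `projIcc` supplies one without changing the integral.
  have hp : ContinuousOn (fun z : Ico a b × ℝ => ((z.1 : ℝ), (projIcc 0 1 zero_le_one z.2 : ℝ)))
      univ := by
    fun_prop
  have h' := h.comp hp fun z _ => ⟨z.1.2, (projIcc 0 1 zero_le_one z.2).2⟩
  rw [continuousOn_univ] at h'
  have : LocallyCompactSpace (Ico a b) := isLocallyClosed_Ico.locallyCompactSpace
  have h2 := intervalIntegral.continuous_parametric_intervalIntegral_of_continuous'
    (μ := volume) (f := fun (x : Ico a b) s => (g x - f x) *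
      Q (x, level f g x (projIcc 0 1 zero_le_one s))) h' 0 1
  rw [continuousOn_iff_continuous_domRestrict]
  refine h2.congr fun x => intervalIntegral.integral_congr fun s hs => ?_
  rw [uIcc_of_le zero_le_one] at hs
  simp only [projIcc_of_mem _ hs]

theorem intervalIntegrable_of_bdd {h : ℝ → ℝ} {C : ℝ} (hc : ContinuousOn h (Ioo 0 1))
    (hb : ∀ s ∈ Ioo (0 : ℝ) 1, |h s| ≤ C) : IntervalIntegrable h volume 0 1 := by
  rw [intervalIntegrable_iff_integrableOn_Ioo_of_le zero_le_one]
  refine IntegrableOn.of_bound (by simp) (hc.aestronglyMeasurable measurableSet_Ioo) C ?_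
  exact (ae_restrict_iff' measurableSet_Ioo).2 (Filter.Eventually.of_forall hb)

theorem level_bdd (hf : IsCurve a b f) (hg : IsCurve a b g) :
    ∃ C, ∀ x ∈ Ioo a b, ∀ s ∈ Ioo (0 : ℝ) 1, |level (deriv f) (deriv g) x s| ≤ C ∧
      |deriv g x - deriv f x| ≤ C := by
  obtain ⟨C, hC⟩ := hf.slope
  obtain ⟨D, hD⟩ := hg.slope
  refine ⟨C + (D + C), fun x hx s hs => ?_⟩
  have h1 := hC x hx
  have h2 := hD x hx
  have h3 : |deriv g x - deriv f x| ≤ D + C := (abs_sub _ _).trans (add_le_add h2 h1)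
  have h0 := (abs_nonneg _).trans h1
  refine ⟨(abs_add_le _ _).trans (add_le_add h1 ?_), h3.trans (by linarith)⟩
  rw [abs_mul, abs_of_pos hs.1]
  nlinarith [hs.2, abs_nonneg (deriv g x - deriv f x)]

theorem continuousOn_section_open {x : ℝ} (hx : x ∈ Ioo a b) (h : f x < g x)
    (hQ : ContinuousOn Q (strip a b f g)) :
    ContinuousOn (fun s => Q (x, level f g x s)) (Ioo 0 1) := by
  refine hQ.comp ?_ fun s hs => level_mem_strip hx h hs
  unfold level
  fun_prop

/-- Derivatives of Q are controlled only in the open strip, so the endpoint s = 1 of `uIoc 0 1` is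
discarded as a null set. -/
theorem ae_mem_uIoc_imp {P : ℝ → Prop} (h : ∀ s ∈ Ioo (0 : ℝ) 1, P s) :
    ∀ᵐ s ∂(volume : Measure ℝ), s ∈ uIoc (0 : ℝ) 1 → P s := by
  have h1 : ∀ᵐ s ∂(volume : Measure ℝ), s ≠ 1 := by
    simp [ae_iff]
  filter_upwards [h1] with s hs hm
  rw [uIoc_of_le zero_le_one] at hm
  exact h s ⟨hm.1, lt_of_le_of_ne hm.2 hs⟩

theorem sectionIntegral_integrable_dx {x : ℝ} (hf : IsCurve a b f) (hg : IsCurve a b g)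
    (hfg : ∀ x ∈ Ico a b, f x < g x) (hQ : IsC1Bdd (strip a b f g) Q) (hx : x ∈ Ioo a b) :
    IntervalIntegrable (fun s => (g x - f x) * dx Q (x, level f g x s)) volume 0 1 := by
  have hΩ := isOpen_strip hf.cont hg.cont
  have hfgx := hfg x (Ioo_subset_Ico_self hx)
  obtain ⟨C, hC⟩ := hQ.2
  exact (intervalIntegrable_of_bdd (continuousOn_section_open hx hfgx (hQ.continuousOn_dx hΩ))
    fun s hs => (hC _ (level_mem_strip hx hfgx hs)).2.1).const_mul _

theorem sectionIntegral_integrable_dy {x : ℝ} (hf : IsCurve a b f) (hg : IsCurve a b g)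
    (hfg : ∀ x ∈ Ico a b, f x < g x) (hQ : IsC1Bdd (strip a b f g) Q) (hx : x ∈ Ioo a b) :
    IntervalIntegrable (fun s => (g x - f x) * dy Q (x, level f g x s)) volume 0 1 := by
  have hΩ := isOpen_strip hf.cont hg.cont
  have hfgx := hfg x (Ioo_subset_Ico_self hx)
  obtain ⟨C, hC⟩ := hQ.2
  exact (intervalIntegrable_of_bdd (continuousOn_section_open hx hfgx (hQ.continuousOn_dy hΩ))
    fun s hs => (hC _ (level_mem_strip hx hfgx hs)).2.2).const_mul _

theorem hasDerivAt_section {x s : ℝ} (hf : IsCurve a b f) (hg : IsCurve a b g)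
    (hfg : ∀ x ∈ Ico a b, f x < g x) (hQ : IsC1Bdd (strip a b f g) Q) (hx : x ∈ Ioo a b)
    (hs : s ∈ Ioo (0 : ℝ) 1) :
    HasDerivAt (fun s => Q (x, level f g x s)) ((g x - f x) * dy Q (x, level f g x s)) s := by
  have h := hQ.differentiableAt (isOpen_strip hf.cont hg.cont)
    (level_mem_strip hx (hfg x (Ioo_subset_Ico_self hx)) hs)
  have h1 := HasDerivAt.comp s (hasDerivAt_dy h) (hasDerivAt_level_right (f := f) (g := g) (x := x))
  rw [mul_comm]
  exact h1

/-- The integral of `∂_y F` over a section. -/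
theorem sectionIntegral_dy {x : ℝ} (hf : IsCurve a b f) (hg : IsCurve a b g)
    (hfg : ∀ x ∈ Ico a b, f x < g x) (hF : IsC1Bdd (strip a b f g) F)
    (hFc : ContinuousOn F (closedStrip a b f g)) (hx : x ∈ Ioo a b) :
    sectionIntegral f g (dy F) x = F (x, g x) - F (x, f x) := by
  have h := intervalIntegral.integral_eq_sub_of_hasDerivAt_of_le zero_le_one
    (continuousOn_section (Ioo_subset_Ico_self hx) (hfg x (Ioo_subset_Ico_self hx)) hFc)
    (fun s hs => hasDerivAt_section hf hg hfg hF hx hs)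
    (sectionIntegral_integrable_dy hf hg hfg hF hx)
  simp only [level_one, level_zero] at h
  exact h

/-- Differentiation under the integral over a moving section. -/
theorem hasDerivAt_sectionIntegral_dx {x : ℝ} (hf : IsCurve a b f) (hg : IsCurve a b g)
    (hfg : ∀ x ∈ Ico a b, f x < g x) (hQ : IsC1Bdd (strip a b f g) Q)
    (hQc : ContinuousOn Q (closedStrip a b f g)) (hx : x ∈ Ioo a b) :
    HasDerivAt (sectionIntegral f g Q) (sectionIntegral f g (dx Q) x
      + (Q (x, g x) * deriv g x - Q (x, f x) * deriv f x)) x := by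
  have hΩ := isOpen_strip hf.cont hg.cont
  obtain ⟨C, hC⟩ := hQ.2
  obtain ⟨D, hD⟩ := level_bdd hf hg
  -- The x-derivative of the integrand at fixed s. The point of level s moves with slope `level
  -- (deriv f) (deriv g) x s`, which brings in `dy Q`.
  let q' : ℝ → ℝ → ℝ := fun x s => (deriv g x - deriv f x) * Q (x, level f g x s)
    + (g x - f x) * (dx Q (x, level f g x s)
      + level (deriv f) (deriv g) x s * dy Q (x, level f g x s))
  have hgf : ContinuousAt (fun x => g x - f x) x :=
    ((hg.diff x hx).continuousAt).sub (hf.diff x hx).continuousAt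
  -- Near x the width of the section is below its value at x plus one. With C bounding Q and its
  -- derivatives and D bounding the slopes, this gives the constant dominating q'.
  have hsmall : ∀ᶠ t in nhds x, t ∈ Ioo a b ∧ g t - f t < g x - f x + 1 :=
    (isOpen_Ioo.eventually_mem hx).and (hgf.eventually (gt_mem_nhds (lt_add_one _)))
  have hI := Ioo_subset_Ico_self (a := a) (b := b)
  have hlev : ContinuousOn (fun s => level (deriv f) (deriv g) x s) (Icc 0 1) := by
    unfold level
    fun_prop
  have hq'c : ContinuousOn (q' x) (Ioo 0 1) := by
    have h1 := (continuousOn_section (hI hx) (hfg x (hI hx)) hQc).mono Ioo_subset_Icc_self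
    have h2 := continuousOn_section_open hx (hfg x (hI hx)) (hQ.continuousOn_dx hΩ)
    have h3 := continuousOn_section_open hx (hfg x (hI hx)) (hQ.continuousOn_dy hΩ)
    exact (continuousOn_const.mul h1).add
      (continuousOn_const.mul (h2.add ((hlev.mono Ioo_subset_Icc_self).mul h3)))
  have hmeas : ∀ h : ℝ → ℝ, ContinuousOn h (Ioo 0 1) →
      AEStronglyMeasurable h (volume.restrict (uIoc (0 : ℝ) 1)) := fun h hh => by
    rw [uIoc_of_le zero_le_one, ← restrict_Ioo_eq_restrict_Ioc]
    exact hh.aestronglyMeasurable measurableSet_Ioo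
  have key := intervalIntegral.hasDerivAt_integral_of_dominated_loc_of_deriv_le (μ := volume)
    (a := 0) (b := 1) (F := fun x s => (g x - f x) * Q (x, level f g x s)) (F' := q') (x₀ := x)
    (bound := fun _ => D * C + (g x - f x + 1) * (C + D * C)) hsmall
    (by
      filter_upwards [hsmall] with t ht
      exact hmeas _ (continuousOn_const.mul
        ((continuousOn_section (hI ht.1) (hfg t (hI ht.1)) hQc).mono Ioo_subset_Icc_self)))
    (((continuousOn_section (hI hx) (hfg x (hI hx)) hQc).intervalIntegrable_of_Icc
      zero_le_one).const_mul _)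
    (hmeas _ hq'c)
    (by
      refine ae_mem_uIoc_imp fun s hs t ht => ?_
      obtain ⟨c1, c2, c3⟩ := hC _ (level_mem_strip ht.1 (hfg t (hI ht.1)) hs)
      obtain ⟨d1, d2⟩ := hD t ht.1 s hs
      have hpos : 0 < g t - f t := sub_pos.2 (hfg t (hI ht.1))
      have hD0 := (abs_nonneg _).trans d1
      have hC0 := (abs_nonneg _).trans c1
      refine (abs_add_le _ _).trans (add_le_add ?_ ?_)
      · rw [abs_mul]
        exact mul_le_mul d2 c1 (abs_nonneg _) hD0
      · rw [abs_mul, abs_of_pos hpos]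
        refine mul_le_mul ht.2.le ((abs_add_le _ _).trans (add_le_add c2 ?_)) (abs_nonneg _)
          (by linarith [ht.2])
        rw [abs_mul]
        exact mul_le_mul d1 c3 (abs_nonneg _) hD0)
    intervalIntegrable_const
    (by
      refine ae_mem_uIoc_imp fun s hs t ht => ?_
      have hz := hQ.differentiableAt hΩ (level_mem_strip ht.1 (hfg t (hI ht.1)) hs)
      have hft := hf.diff t ht.1
      have hgt := hg.diff t ht.1
      have h1 : HasDerivAt (fun t => Q (t, level f g t s))
          (fderiv ℝ Q (t, level f g t s) (1, level (deriv f) (deriv g) t s)) t :=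
        HasFDerivAt.comp_hasDerivAt (f := fun t => (t, level f g t s)) t hz.hasFDerivAt
          ((hasDerivAt_id t).prodMk (hasDerivAt_level_left hft hgt))
      rw [fderiv_apply_eq hz, one_mul] at h1
      exact (hgt.hasDerivAt.sub hft.hasDerivAt).mul h1)
  have hint := sectionIntegral_integrable_dx hf hg hfg hQ hx
  have hrest : IntervalIntegrable (fun s => q' x s - (g x - f x) * dx Q (x, level f g x s))
      volume 0 1 := key.1.sub hint
  -- Apart from its `dx Q` term, q' is the exact s-derivative of Q times the slope of the level
  -- curve, so it integrates to the two boundary terms.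
  have hftc := intervalIntegral.integral_eq_sub_of_hasDerivAt_of_le zero_le_one
    (f := fun s => Q (x, level f g x s) * level (deriv f) (deriv g) x s)
    (f' := fun s => q' x s - (g x - f x) * dx Q (x, level f g x s))
    ((continuousOn_section (hI hx) (hfg x (hI hx)) hQc).mul hlev)
    (fun s hs => by
      refine ((hasDerivAt_section hf hg hfg hQ hx hs).mul
        (hasDerivAt_level_right (f := deriv f) (g := deriv g) (x := x))).congr_deriv ?_
      simp only [q']
      ring) hrest
  simp only [level_one, level_zero] at hftc
  refine key.2.congr_deriv ?_
  rw [← hftc, sectionIntegral, ← intervalIntegral.integral_add hint hrest]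
  simp

/-- Reynolds' transport theorem for the density `Q` with flux `F`. -/
theorem hasDerivAt_sectionIntegral {x : ℝ} (hf : IsCurve a b f) (hg : IsCurve a b g)
    (hfg : ∀ x ∈ Ico a b, f x < g x) (hQ : IsC1Bdd (strip a b f g) Q)
    (hQc : ContinuousOn Q (closedStrip a b f g)) (hF : IsC1Bdd (strip a b f g) F)
    (hFc : ContinuousOn F (closedStrip a b f g)) (hx : x ∈ Ioo a b) :
    HasDerivAt (sectionIntegral f g Q) (sectionIntegral f g (fun z => dx Q z + dy F z) x
      - (F (x, g x) - deriv g x * Q (x, g x)) + (F (x, f x) - deriv f x * Q (x, f x))) x := by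
  refine (hasDerivAt_sectionIntegral_dx hf hg hfg hQ hQc hx).congr_deriv ?_
  have h1 : sectionIntegral f g (fun z => dx Q z + dy F z) x
      = sectionIntegral f g (dx Q) x + sectionIntegral f g (dy F) x := by
    simp only [sectionIntegral]
    rw [← intervalIntegral.integral_add (sectionIntegral_integrable_dx hf hg hfg hQ hx)
      (sectionIntegral_integrable_dy hf hg hfg hF hx)]
    simp only [mul_add]
  rw [h1, sectionIntegral_dy hf hg hfg hF hFc hx]
  ring

/-- A production bounded by the density is bounded after integration. -/
theorem sectionIntegral_production_le {x K : ℝ} (hf : IsCurve a b f) (hg : IsCurve a b g)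
    (hfg : ∀ x ∈ Ico a b, f x < g x) (hQ : IsC1Bdd (strip a b f g) Q)
    (hQc : ContinuousOn Q (closedStrip a b f g)) (hF : IsC1Bdd (strip a b f g) F)
    (hK : ∀ z ∈ strip a b f g, dx Q z + dy F z ≤ K * Q z) (hx : x ∈ Ioo a b) :
    sectionIntegral f g (fun z => dx Q z + dy F z) x ≤ K * sectionIntegral f g Q x := by
  have hI := Ioo_subset_Ico_self (a := a) (b := b)
  simp only [sectionIntegral]
  rw [← intervalIntegral.integral_const_mul]
  refine intervalIntegral.integral_mono_on_of_le_Ioo zero_le_one ?_ ?_ fun s hs => ?_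
  · simpa only [mul_add] using (sectionIntegral_integrable_dx hf hg hfg hQ hx).add
      (sectionIntegral_integrable_dy hf hg hfg hF hx)
  · exact (((continuousOn_section (hI hx) (hfg x (hI hx)) hQc).intervalIntegrable_of_Icc
      zero_le_one).const_mul _).const_mul _
  · have h1 := hK _ (level_mem_strip hx (hfg x (hI hx)) hs)
    have h2 : 0 < g x - f x := sub_pos.2 (hfg x (hI hx))
    nlinarith

theorem sectionIntegral_nonneg {x : ℝ} (hfg : ∀ x ∈ Ico a b, f x < g x)
    (hQ0 : ∀ z ∈ closedStrip a b f g, 0 ≤ Q z) (hx : x ∈ Ico a b) :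
    0 ≤ sectionIntegral f g Q x :=
  intervalIntegral.integral_nonneg zero_le_one fun _ hs =>
    mul_nonneg (sub_pos.2 (hfg x hx)).le (hQ0 _ (level_mem_closedStrip hx (hfg x hx) hs))

theorem eq_zero_of_sectionIntegral_nonpos {x y : ℝ} (hfg : ∀ x ∈ Ico a b, f x < g x)
    (hQc : ContinuousOn Q (closedStrip a b f g)) (hQ0 : ∀ z ∈ closedStrip a b f g, 0 ≤ Q z)
    (hx : x ∈ Ico a b) (h : sectionIntegral f g Q x ≤ 0) (hy : y ∈ Icc (f x) (g x)) :
    Q (x, y) = 0 := by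
  obtain ⟨s, hs, rfl⟩ := exists_level_eq (hfg x hx) hy
  have hpos : 0 < g x - f x := sub_pos.2 (hfg x hx)
  have hm : ∀ s ∈ Icc (0 : ℝ) 1, 0 ≤ Q (x, level f g x s) :=
    fun s hs => hQ0 _ (level_mem_closedStrip hx (hfg x hx) hs)
  by_contra hne
  refine absurd h (not_le.2 ?_)
  refine intervalIntegral.integral_pos zero_lt_one
    (continuousOn_const.mul (continuousOn_section hx (hfg x hx) hQc))
    (fun t ht => mul_nonneg hpos.le (hm t (Ioc_subset_Icc_self ht)))
    ⟨s, hs, mul_pos hpos (lt_of_le_of_ne (hm s hs) (Ne.symm hne))⟩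

end Sections

/-- Gronwall: a continuous function with `E(a) = 0` and `E' ≤ K E` is nonpositive. -/
theorem nonpos_of_deriv_le_mul {a b K : ℝ} {E E' : ℝ → ℝ} (hc : ContinuousOn E (Ico a b))
    (hd : ∀ x ∈ Ioo a b, HasDerivAt E (E' x) x) (hle : ∀ x ∈ Ioo a b, E' x ≤ K * E x)
    (h0 : E a = 0) {x : ℝ} (hx : x ∈ Ico a b) : E x ≤ 0 := by
  have hd' : ∀ x ∈ Ioo a b, HasDerivAt (fun x => Real.exp (-K * x) * E x)
      (Real.exp (-K * x) * (E' x - K * E x)) x := fun x hx => by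
    have h1 : HasDerivAt (fun x => Real.exp (-K * x)) (Real.exp (-K * x) * -K) x := by
      simpa using ((hasDerivAt_id x).const_mul (-K)).exp
    exact (h1.mul (hd x hx)).congr_deriv (by ring)
  have hanti : AntitoneOn (fun x => Real.exp (-K * x) * E x) (Ico a b) := by
    refine antitoneOn_of_deriv_nonpos (convex_Ico a b) ?_ ?_ ?_
    · exact ContinuousOn.mul (by fun_prop) hc
    · rw [interior_Ico]
      exact fun x hx => (hd' x hx).differentiableAt.differentiableWithinAt
    · rw [interior_Ico]
      intro x hx
      rw [(hd' x hx).deriv]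
      exact mul_nonpos_of_nonneg_of_nonpos (Real.exp_pos _).le (by linarith [hle x hx])
  have h := hanti ⟨le_rfl, hx.1.trans_lt hx.2⟩ hx hx.1
  simp only [h0, mul_zero] at h
  exact nonpos_of_mul_nonpos_right h (Real.exp_pos _)

/-! ## The relative energy -/

/-- The total enthalpy `E + p / ρ`. -/
def Gas.enthalpy (G : Gas) (U : FlowState) : ℝ := G.energy U + U.p / U.ρ

theorem Gas.one_lt_γ (G : Gas) : 1 < G.γ := by
  have := div_pos G.R_pos G.cv_pos
  simp only [Gas.γ]
  linarith

theorem Gas.γ_pos (G : Gas) : 0 < G.γ := zero_lt_one.trans G.one_lt_γ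

/-- The density of the energy relative to the state `W`. -/
def Gas.relEnergy (G : Gas) (W U : FlowState) : ℝ :=
  U.ρ * U.u * (((U.u - W.u) ^ 2 + U.v ^ 2) * 2⁻¹ + U.Y ^ 2 + (G.enthalpy U - G.enthalpy W) ^ 2)
    + (U.u - W.u) * (U.p - W.p) + U.u / (G.γ * U.p) * ((U.p - W.p) ^ 2 * 2⁻¹)

/-- The transversal flux of the energy relative to the state `W`. -/
def Gas.relFlux (G : Gas) (W U : FlowState) : ℝ :=
  U.ρ * U.v * (((U.u - W.u) ^ 2 + U.v ^ 2) * 2⁻¹ + U.Y ^ 2 + (G.enthalpy U - G.enthalpy W) ^ 2)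
    + U.v * (U.p - W.p) + U.v / (G.γ * U.p) * ((U.p - W.p) ^ 2 * 2⁻¹)

/-- The flux through a slip curve of slope `m` only sees the pressure. -/
theorem Gas.relFlux_sub_of_slip (G : Gas) (W U : FlowState) {m : ℝ} (h : normalVelocity U m = 0) :
    G.relFlux W U - m * G.relEnergy W U = m * W.u * (U.p - W.p) := by
  have hs : Real.sqrt (1 + m ^ 2) ≠ 0 := (Real.sqrt_pos.2 (by positivity)).ne'
  have hv : U.v = m * U.u := by
    rw [normalVelocity, div_eq_zero_iff, or_iff_left hs] at h
    linarith
  simp only [relFlux, relEnergy]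
  rw [hv]
  ring

/-- Quantitative nondegeneracy of a state: positivity, supersonicity in the direction of `x`, and
a bound for the reaction rate. -/
structure Gas.Nondegenerate (G : Gas) (κ K : ℝ) (U : FlowState) : Prop where
  p : κ ≤ U.p
  ρ : κ ≤ U.ρ
  flux : κ ≤ U.ρ * U.u
  supersonic : κ ≤ (U.u / (G.γ * U.p) - (U.ρ * U.u)⁻¹) * 2⁻¹
  rate : |G.φ (G.temp U)| ≤ K

/-- Complete the square in (u - W.u) ρu + (p - W.p). What remains of (p - W.p)² has the coefficient
(u / (γp) - 1 / (ρu)) / 2, which is positive exactly when ρu² > γp, that is u > c;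
`Nondegenerate.supersonic` bounds it below by κ. -/
theorem Gas.Nondegenerate.mul_le_relEnergy {G : Gas} {κ K : ℝ} {W U : FlowState} (hκ : 0 < κ)
    (h : G.Nondegenerate κ K U) : κ * ((U.p - W.p) ^ 2 + U.Y ^ 2
      + (U.v ^ 2 * 2⁻¹ + (G.enthalpy U - G.enthalpy W) ^ 2))
      + ((U.u - W.u) * (U.ρ * U.u) + (U.p - W.p)) ^ 2 * (2 * (U.ρ * U.u))⁻¹ ≤ G.relEnergy W U := by
  have hm : 0 < U.ρ * U.u := hκ.trans_le h.flux
  have h1 := mul_le_mul_of_nonneg_right h.supersonic (sq_nonneg (U.p - W.p))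
  have h2 := mul_le_mul_of_nonneg_right h.flux (sq_nonneg U.Y)
  have h3 := mul_le_mul_of_nonneg_right h.flux (sq_nonneg U.v)
  have h4 := mul_le_mul_of_nonneg_right h.flux (sq_nonneg (G.enthalpy U - G.enthalpy W))
  have h5 : ((U.u - W.u) * (U.ρ * U.u) + (U.p - W.p)) ^ 2 * (2 * (U.ρ * U.u))⁻¹
      = U.ρ * U.u * ((U.u - W.u) ^ 2 * 2⁻¹) + (U.u - W.u) * (U.p - W.p)
        + (U.ρ * U.u)⁻¹ * ((U.p - W.p) ^ 2 * 2⁻¹) := by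
    generalize U.ρ * U.u = m at hm
    generalize U.u - W.u = d
    field_simp
    ring
  rw [h5, relEnergy]
  nlinarith

theorem Gas.Nondegenerate.relEnergy_nonneg {G : Gas} {κ K : ℝ} {W U : FlowState} (hκ : 0 < κ)
    (h : G.Nondegenerate κ K U) : 0 ≤ G.relEnergy W U := by
  have hm : 0 < U.ρ * U.u := hκ.trans_le h.flux
  exact le_trans (by positivity) (h.mul_le_relEnergy hκ)

/-- The two squares kept are those that control the production of the energy. -/
theorem Gas.Nondegenerate.sq_add_sq_le {G : Gas} {κ K : ℝ} {W U : FlowState} (hκ : 0 < κ)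
    (h : G.Nondegenerate κ K U) : (U.p - W.p) ^ 2 + U.Y ^ 2 ≤ κ⁻¹ * G.relEnergy W U := by
  have hm : 0 < U.ρ * U.u := hκ.trans_le h.flux
  rw [le_inv_mul_iff₀ hκ]
  refine le_trans ?_ (h.mul_le_relEnergy hκ)
  have h1 : 0 ≤ κ * (U.v ^ 2 * 2⁻¹ + (G.enthalpy U - G.enthalpy W) ^ 2) := by positivity
  have h2 : 0 ≤ ((U.u - W.u) * (U.ρ * U.u) + (U.p - W.p)) ^ 2 * (2 * (U.ρ * U.u))⁻¹ := by
    positivity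
  linarith

theorem Gas.enthalpy_eq (G : Gas) (U : FlowState) (h : U.ρ ≠ 0) :
    G.enthalpy U = (U.u ^ 2 + U.v ^ 2) / 2 + (G.cv / G.R + 1) * (U.p / U.ρ) + G.q0 * U.Y := by
  have := G.R_pos.ne'
  simp only [enthalpy, energy, temp]
  field_simp
  ring

/-- A state of vanishing energy relative to a uniform state is that state. -/
theorem Gas.Nondegenerate.eq_of_relEnergy_eq_zero {G : Gas} {κ K u p ρ : ℝ} {U : FlowState}
    (hκ : 0 < κ) (hp : 0 < p) (hρ : 0 < ρ) (h : G.Nondegenerate κ K U)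
    (h0 : G.relEnergy (uniformState u p ρ) U = 0) : U = uniformState u p ρ := by
  have hm : 0 < U.ρ * U.u := hκ.trans_le h.flux
  have hle := h.mul_le_relEnergy (W := uniformState u p ρ) hκ
  rw [h0] at hle
  -- A is the completed square and κ * B collects the other squares. Both are nonnegative and their
  -- sum is at most zero, so both vanish.
  set A := ((U.u - (uniformState u p ρ).u) * (U.ρ * U.u) + (U.p - (uniformState u p ρ).p)) ^ 2
    * (2 * (U.ρ * U.u))⁻¹ with hA
  set B := (U.p - (uniformState u p ρ).p) ^ 2 + U.Y ^ 2
      + (U.v ^ 2 * 2⁻¹ + (G.enthalpy U - G.enthalpy (uniformState u p ρ)) ^ 2) with hB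
  have hA0 : 0 ≤ A := by positivity
  have hB0 : 0 ≤ κ * B := by positivity
  have hBz : B = 0 := (mul_eq_zero.1 (by linarith : κ * B = 0)).resolve_left hκ.ne'
  have hAz : A = 0 := by linarith
  have e1 : U.p - (uniformState u p ρ).p = 0 := by
    refine pow_eq_zero_iff two_ne_zero |>.1 (le_antisymm ?_ (sq_nonneg _))
    nlinarith [sq_nonneg U.Y, sq_nonneg U.v,
      sq_nonneg (G.enthalpy U - G.enthalpy (uniformState u p ρ))]
  have e2 : U.Y = 0 := by
    refine pow_eq_zero_iff two_ne_zero |>.1 (le_antisymm ?_ (sq_nonneg _))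
    nlinarith [sq_nonneg (U.p - (uniformState u p ρ).p), sq_nonneg U.v,
      sq_nonneg (G.enthalpy U - G.enthalpy (uniformState u p ρ))]
  have e3 : U.v = 0 := by
    refine pow_eq_zero_iff two_ne_zero |>.1 (le_antisymm ?_ (sq_nonneg _))
    nlinarith [sq_nonneg (U.p - (uniformState u p ρ).p), sq_nonneg U.Y,
      sq_nonneg (G.enthalpy U - G.enthalpy (uniformState u p ρ))]
  have e4 : G.enthalpy U - G.enthalpy (uniformState u p ρ) = 0 := by
    refine pow_eq_zero_iff two_ne_zero |>.1 (le_antisymm ?_ (sq_nonneg _))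
    nlinarith [sq_nonneg (U.p - (uniformState u p ρ).p), sq_nonneg U.Y, sq_nonneg U.v]
  -- Once the pressures agree, the completed square is a positive multiple of (u - W.u)².
  have e5 : U.u - (uniformState u p ρ).u = 0 := by
    rw [hA, e1, add_zero, mul_eq_zero, or_iff_left (inv_pos.2 (by positivity)).ne',
      pow_eq_zero_iff two_ne_zero, mul_eq_zero, or_iff_left hm.ne'] at hAz
    exact hAz
  have hρU : 0 < U.ρ := hκ.trans_le h.ρ
  rw [G.enthalpy_eq _ hρU.ne', G.enthalpy_eq _ (by simpa [uniformState] using hρ.ne'), e2, e3,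
    sub_eq_zero.1 e1, sub_eq_zero.1 e5] at e4
  simp only [uniformState] at e1 e5 e4
  have hk : G.cv / G.R + 1 ≠ 0 := by
    have := div_pos G.cv_pos G.R_pos
    linarith
  -- Equal enthalpies with equal u, v and Y leave equal p / ρ; the pressures agree, hence so do the
  -- densities.
  have e6 : p / U.ρ = p / ρ := mul_left_cancel₀ hk (by linarith)
  have e7 : U.ρ = ρ := by
    field_simp at e6
    linarith
  exact FlowState.ext (sub_eq_zero.1 e5) e3 (sub_eq_zero.1 e1) e7 e2

/-! ## The balance of the relative energy -/

/-- `V'` is the componentwise derivative at `t` of the path `V` of states. -/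
structure HasFlowDerivAt (V : ℝ → FlowState) (V' : FlowState) (t : ℝ) : Prop where
  u : HasDerivAt (fun s => (V s).u) V'.u t
  v : HasDerivAt (fun s => (V s).v) V'.v t
  p : HasDerivAt (fun s => (V s).p) V'.p t
  ρ : HasDerivAt (fun s => (V s).ρ) V'.ρ t
  Y : HasDerivAt (fun s => (V s).Y) V'.Y t

/-- The derivative is arranged to match `hhx` and `hhy` in `relEnergy_balance_algebra`, with k = c_ν
/ R = 1 / (γ - 1), hence k + 1 = γ / (γ - 1). -/
theorem HasFlowDerivAt.enthalpy {V : ℝ → FlowState} {V' : FlowState} {t : ℝ}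
    (h : HasFlowDerivAt V V' t) (G : Gas) (hρ : (V t).ρ ≠ 0) :
    HasDerivAt (fun s => G.enthalpy (V s)) ((V t).u * V'.u + (V t).v * V'.v
      + (G.cv / G.R + 1) * ((V'.p * (V t).ρ - (V t).p * V'.ρ) / (V t).ρ ^ 2) + G.q0 * V'.Y) t := by
  have hR := G.R_pos.ne'
  have hT := h.p.fun_div (h.ρ.const_mul G.R) (mul_ne_zero hR hρ)
  have hE := (((((h.u.fun_pow 2).fun_add (h.v.fun_pow 2)).div_const 2).fun_add
    (hT.const_mul G.cv)).fun_add (h.Y.const_mul G.q0)).fun_add (h.p.fun_div h.ρ hρ)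
  refine hE.congr_deriv ?_
  field_simp
  ring

/-- The Euler equations in nonconservative form imply the balance of the relative energy. -/
theorem relEnergy_balance_algebra {γ k q ρ u v p Y H φ w : ℝ} {W : FlowState} {Hw : ℝ}
    {X D : FlowState} {hx hy ax bY : ℝ} (hρ : ρ ≠ 0) (hk : k ≠ 0) (hγ : γ = 1 + k⁻¹)
    (hw : γ * p * w = 1)
    (hhx : hx = u * X.u + v * X.v + (k + 1) * ((X.p * ρ - p * X.ρ) / ρ ^ 2) + q * X.Y)
    (hhy : hy = u * D.u + v * D.v + (k + 1) * ((D.p * ρ - p * D.ρ) / ρ ^ 2) + q * D.Y)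
    (e1 : (X.ρ * u + ρ * X.u) + (D.ρ * v + ρ * D.v) = 0)
    (e2 : (X.ρ * u ^ 2 + ρ * (2 * u * X.u) + X.p) + ((D.ρ * u + ρ * D.u) * v + ρ * u * D.v) = 0)
    (e3 : ((X.ρ * u + ρ * X.u) * v + ρ * u * X.v) + (D.ρ * v ^ 2 + ρ * (2 * v * D.v) + D.p) = 0)
    (e4 : ((X.ρ * u + ρ * X.u) * H + ρ * u * hx) + ((D.ρ * v + ρ * D.v) * H + ρ * v * hy) = 0)
    (e5 : ((X.ρ * u + ρ * X.u) * Y + ρ * u * X.Y) + ((D.ρ * v + ρ * D.v) * Y + ρ * v * D.Y)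
      = -(ρ * φ * Y)) :
    ((X.ρ * u + ρ * X.u) * (((u - W.u) ^ 2 + v ^ 2) * 2⁻¹ + Y ^ 2 + (H - Hw) ^ 2)
      + ρ * u * ((2 * (u - W.u) * X.u + 2 * v * X.v) * 2⁻¹ + 2 * Y * X.Y + 2 * (H - Hw) * hx)
      + (X.u * (p - W.p) + (u - W.u) * X.p)
      + (ax * ((p - W.p) ^ 2 * 2⁻¹) + u * w * (2 * (p - W.p) * X.p * 2⁻¹)))
    + ((D.ρ * v + ρ * D.v) * (((u - W.u) ^ 2 + v ^ 2) * 2⁻¹ + Y ^ 2 + (H - Hw) ^ 2)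
      + ρ * v * ((2 * (u - W.u) * D.u + 2 * v * D.v) * 2⁻¹ + 2 * Y * D.Y + 2 * (H - Hw) * hy)
      + (D.v * (p - W.p) + v * D.p)
      + (bY * ((p - W.p) ^ 2 * 2⁻¹) + v * w * (2 * (p - W.p) * D.p * 2⁻¹)))
    = k⁻¹ * q * ρ * φ * w * (Y * (p - W.p)) - 2 * ρ * φ * Y ^ 2
      + (ax + bY) * 2⁻¹ * (p - W.p) ^ 2 := by
  -- Removing a multiple of the mass equation turns conservation laws into transport along
  -- streamlines: H is constant there and Y is consumed by the reaction.
  have hHt : ρ * (u * hx + v * hy) = 0 := by linear_combination e4 - H * e1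
  have hYt : ρ * (u * X.Y + v * D.Y) = -(ρ * φ * Y) := by linear_combination e5 - Y * e1
  -- The pressure equation. From the transport of H, the momentum equations eliminate the kinetic
  -- part and the mass equation eliminates the derivatives of ρ; the reaction is left as a heat
  -- source.
  have hpr : u * X.p + v * D.p + γ * p * (X.u + D.v) = k⁻¹ * q * ρ * φ * Y := by
    have h1 : ρ * (u * X.u + v * D.u) + X.p = 0 := by linear_combination e2 - u * e1
    have h2 : ρ * (u * X.v + v * D.v) + D.p = 0 := by linear_combination e3 - v * e1
    have h3 : u * ((X.p * ρ - p * X.ρ) / ρ ^ 2) * ρ + v * ((D.p * ρ - p * D.ρ) / ρ ^ 2) * ρ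
        = u * X.p + v * D.p + p * (X.u + D.v) := by
      field_simp
      linear_combination (-p) * e1
    have h4 : k * (u * X.p + v * D.p) + (k + 1) * p * (X.u + D.v) = q * ρ * φ * Y := by
      rw [hhx, hhy] at hHt
      linear_combination hHt - (k + 1) * h3 - u * h1 - v * h2 - q * hYt
    rw [hγ]
    field_simp
    linear_combination h4
  -- The pressure gradient in the momentum equations and the velocity divergence in the pressure
  -- equation combine into the divergence of ((u - W.u)(p - W.p), v(p - W.p)). The derivatives `ax`
  -- and `bY` of u / (γp) and v / (γp) are not expanded: they stay in the production.
  linear_combination (((u - W.u) ^ 2 + v ^ 2) * 2⁻¹ + Y ^ 2 + (H - Hw) ^ 2) * e1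
    + (u - W.u) * (e2 - u * e1) + v * (e3 - v * e1) + 2 * (H - Hw) * hHt + 2 * Y * hYt
    + (p - W.p) * w * hpr - (p - W.p) * (X.u + D.v) * hw

/-- The balance of the relative energy for a solution of the combustion Euler equations. -/
theorem Gas.relEnergy_balance (G : Gas) (W : FlowState) {U : ℝ × ℝ → FlowState} {z : ℝ × ℝ}
    (hu : DifferentiableAt ℝ (fun w => (U w).u) z) (hv : DifferentiableAt ℝ (fun w => (U w).v) z)
    (hp : DifferentiableAt ℝ (fun w => (U w).p) z) (hρ : DifferentiableAt ℝ (fun w => (U w).ρ) z)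
    (hY : DifferentiableAt ℝ (fun w => (U w).Y) z) (hp0 : (U z).p ≠ 0) (hρ0 : (U z).ρ ≠ 0)
    (he : G.EulerAt U z) :
    dx (fun w => G.relEnergy W (U w)) z + dy (fun w => G.relFlux W (U w)) z
      = (G.cv / G.R)⁻¹ * G.q0 * (U z).ρ * G.φ (G.temp (U z)) * (G.γ * (U z).p)⁻¹
          * ((U z).Y * ((U z).p - W.p)) - 2 * (U z).ρ * G.φ (G.temp (U z)) * (U z).Y ^ 2
        + (dx (fun w => (U w).u / (G.γ * (U w).p)) z + dy (fun w => (U w).v / (G.γ * (U w).p)) z)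
          * 2⁻¹ * ((U z).p - W.p) ^ 2 := by
  have hγ0 : G.γ * (U z).p ≠ 0 := mul_ne_zero G.γ_pos.ne' hp0
  have hd : DifferentiableAt ℝ (fun w => G.γ * (U w).p) z := hp.const_mul _
  have hwu : DifferentiableAt ℝ (fun w => (U w).u / (G.γ * (U w).p)) z := by
    simp only [div_eq_mul_inv]
    exact hu.fun_mul (hd.fun_inv hγ0)
  have hwv : DifferentiableAt ℝ (fun w => (U w).v / (G.γ * (U w).p)) z := by
    simp only [div_eq_mul_inv]
    exact hv.fun_mul (hd.fun_inv hγ0)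
  set X : FlowState := ⟨dx (fun w => (U w).u) z, dx (fun w => (U w).v) z,
    dx (fun w => (U w).p) z, dx (fun w => (U w).ρ) z, dx (fun w => (U w).Y) z⟩ with hX
  set D : FlowState := ⟨dy (fun w => (U w).u) z, dy (fun w => (U w).v) z,
    dy (fun w => (U w).p) z, dy (fun w => (U w).ρ) z, dy (fun w => (U w).Y) z⟩ with hD
  have x : HasFlowDerivAt (fun s => U (s, z.2)) X z.1 :=
    ⟨hasDerivAt_dx hu, hasDerivAt_dx hv, hasDerivAt_dx hp, hasDerivAt_dx hρ, hasDerivAt_dx hY⟩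
  have y : HasFlowDerivAt (fun s => U (z.1, s)) D z.2 :=
    ⟨hasDerivAt_dy hu, hasDerivAt_dy hv, hasDerivAt_dy hp, hasDerivAt_dy hρ, hasDerivAt_dy hY⟩
  have hx := x.enthalpy G hρ0
  have hy := y.enthalpy G hρ0
  have hax : HasDerivAt (fun s => (U (s, z.2)).u / (G.γ * (U (s, z.2)).p))
      (dx (fun w => (U w).u / (G.γ * (U w).p)) z) z.1 :=
    hasDerivAt_dx hwu
  have hby : HasDerivAt (fun s => (U (z.1, s)).v / (G.γ * (U (z.1, s)).p))
      (dy (fun w => (U w).v / (G.γ * (U w).p)) z) z.2 :=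
    hasDerivAt_dy hwv
  obtain ⟨e1, e2, e3, e4, e5⟩ := he
  have mx := x.ρ.fun_mul x.u
  have my := y.ρ.fun_mul y.v
  -- Here and below the right-hand side `_` is filled by unification with the derivative that the
  -- product rule produces.
  have e1' : dx (fun w => (U w).ρ * (U w).u) z + dy (fun w => (U w).ρ * (U w).v) z = _ :=
    congrArg₂ (· + ·) mx.deriv my.deriv
  have e2' : dx (fun w => (U w).ρ * (U w).u ^ 2 + (U w).p) z
      + dy (fun w => (U w).ρ * (U w).u * (U w).v) z = _ :=
    congrArg₂ (· + ·) ((x.ρ.fun_mul (x.u.fun_pow 2)).fun_add x.p).deriv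
      ((y.ρ.fun_mul y.u).fun_mul y.v).deriv
  have e3' : dx (fun w => (U w).ρ * (U w).u * (U w).v) z
      + dy (fun w => (U w).ρ * (U w).v ^ 2 + (U w).p) z = _ :=
    congrArg₂ (· + ·) (mx.fun_mul x.v).deriv
      ((y.ρ.fun_mul (y.v.fun_pow 2)).fun_add y.p).deriv
  have e4' : dx (fun w => (U w).ρ * (U w).u * (G.energy (U w) + (U w).p / (U w).ρ)) z
      + dy (fun w => (U w).ρ * (U w).v * (G.energy (U w) + (U w).p / (U w).ρ)) z = _ :=
    congrArg₂ (· + ·) (mx.fun_mul hx).deriv (my.fun_mul hy).deriv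
  have e5' : dx (fun w => (U w).ρ * (U w).u * (U w).Y) z
      + dy (fun w => (U w).ρ * (U w).v * (U w).Y) z = _ :=
    congrArg₂ (· + ·) (mx.fun_mul x.Y).deriv (my.fun_mul y.Y).deriv
  have eQ : dx (fun w => G.relEnergy W (U w)) z = _ :=
    ((mx.fun_mul ((((((x.u.sub_const W.u).fun_pow 2).fun_add (x.v.fun_pow 2)).mul_const
      (2⁻¹ : ℝ)).fun_add (x.Y.fun_pow 2)).fun_add ((hx.sub_const (G.enthalpy W)).fun_pow 2))).fun_add
      ((x.u.sub_const W.u).fun_mul (x.p.sub_const W.p))).fun_add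
      (hax.fun_mul (((x.p.sub_const W.p).fun_pow 2).mul_const (2⁻¹ : ℝ))) |>.deriv
  have eF : dy (fun w => G.relFlux W (U w)) z = _ :=
    ((my.fun_mul ((((((y.u.sub_const W.u).fun_pow 2).fun_add (y.v.fun_pow 2)).mul_const
      (2⁻¹ : ℝ)).fun_add (y.Y.fun_pow 2)).fun_add ((hy.sub_const (G.enthalpy W)).fun_pow 2))).fun_add
      (y.v.fun_mul (y.p.sub_const W.p))).fun_add
      (hby.fun_mul (((y.p.sub_const W.p).fun_pow 2).mul_const (2⁻¹ : ℝ))) |>.deriv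
  rw [e1'] at e1
  rw [e2'] at e2
  rw [e3'] at e3
  rw [e4'] at e4
  rw [e5'] at e5
  rw [eQ, eF]
  have hR := G.R_pos.ne'
  have hcv := G.cv_pos.ne'
  rw [← relEnergy_balance_algebra (γ := G.γ) (k := G.cv / G.R) (q := G.q0) (ρ := (U z).ρ)
    (u := (U z).u) (v := (U z).v) (p := (U z).p) (Y := (U z).Y) (H := G.enthalpy (U z))
    (φ := G.φ (G.temp (U z))) (W := W) (Hw := G.enthalpy W) (X := X) (D := D)
    (w := (G.γ * (U z).p)⁻¹) hρ0 (div_ne_zero hcv hR) (by rw [Gas.γ, inv_div])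
    (mul_inv_cancel₀ hγ0) rfl rfl (by linear_combination e1) (by linear_combination e2)
    (by linear_combination e3) (by linear_combination e4) (by linear_combination e5)]
  ring

/-! ## Layers close to a supersonic uniform state -/

theorem Gas.temp_pos (G : Gas) {U : FlowState} (hp : 0 < U.p) (hρ : 0 < U.ρ) : 0 < G.temp U :=
  div_pos hp (mul_pos G.R_pos hρ)

theorem ContinuousFlowOn.mono {U : ℝ × ℝ → FlowState} {S S' : Set (ℝ × ℝ)}
    (h : ContinuousFlowOn U S) (hS : S' ⊆ S) : ContinuousFlowOn U S' :=
  ⟨h.1.mono hS, h.2.1.mono hS, h.2.2.1.mono hS, h.2.2.2.1.mono hS, h.2.2.2.2.mono hS⟩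

/-- A uniform state that is supersonic in the direction of `x`. -/
structure Gas.IsSupersonic (G : Gas) (W : FlowState) : Prop where
  p : 0 < W.p
  ρ : 0 < W.ρ
  u : 0 < W.u
  sonic : G.γ * W.p < W.ρ * W.u ^ 2

/-- States close to a supersonic state are uniformly nondegenerate. -/
theorem Gas.IsSupersonic.eventually_nondegenerate {G : Gas} {W : FlowState}
    (h : G.IsSupersonic W) (hφ : ContinuousOn G.φ (Ioi 0)) :
    ∃ κ > 0, ∃ K, ∀ (U : ℝ × ℝ → FlowState) (S : Set (ℝ × ℝ)), ContinuousFlowOn U S →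
      ∀ z ∈ S, U z = W → ∀ᶠ w in nhdsWithin z S, G.Nondegenerate κ K (U w) := by
  have hγ := G.γ_pos
  have hs : 0 < (W.u / (G.γ * W.p) - (W.ρ * W.u)⁻¹) * 2⁻¹ := by
    have h1 := h.p
    have h2 := h.ρ
    have h3 := h.u
    have h4 : (W.ρ * W.u)⁻¹ < W.u / (G.γ * W.p) := by
      rw [inv_eq_one_div, div_lt_div_iff₀ (by positivity) (by positivity)]
      nlinarith [h.sonic]
    linarith
  -- κ lies strictly below four positive values at W, and K will lie strictly above |φ(T)| at W, so
  -- all bounds persist near a point where U = W. Neither constant depends on U or S.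
  obtain ⟨κ, hκ, hκ'⟩ := exists_between (lt_min (lt_min h.p h.ρ)
    (lt_min (mul_pos h.ρ h.u) hs))
  simp only [lt_min_iff] at hκ'
  obtain ⟨⟨k1, k2⟩, k3, k4⟩ := hκ'
  refine ⟨κ, hκ, |G.φ (G.temp W)| + 1, fun U S ⟨cu, cv, cp, cρ, cY⟩ z hz hW => ?_⟩
  have cu := cu z hz
  have cp := cp z hz
  have cρ := cρ z hz
  have hp0 : (U z).p ≠ 0 := by rw [hW]; exact h.p.ne'
  have hρ0 : (U z).ρ ≠ 0 := by rw [hW]; exact h.ρ.ne'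
  have hu0 : (U z).u ≠ 0 := by rw [hW]; exact h.u.ne'
  have cT : ContinuousWithinAt (fun w => G.temp (U w)) S z :=
    cp.div (cρ.const_mul G.R) (mul_ne_zero G.R_pos.ne' hρ0)
  have hT0 : 0 < G.temp (U z) := by rw [hW]; exact G.temp_pos h.p h.ρ
  have cφ : ContinuousWithinAt (fun w => |G.φ (G.temp (U w))|) S z :=
    (ContinuousAt.comp_continuousWithinAt (f := fun w => G.temp (U w))
      (hφ.continuousAt (Ioi_mem_nhds hT0)) cT).abs
  have cs : ContinuousWithinAt (fun w => ((U w).u / (G.γ * (U w).p)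
      - ((U w).ρ * (U w).u)⁻¹) * 2⁻¹) S z :=
    ((cu.div (cp.const_mul G.γ) (mul_ne_zero hγ.ne' hp0)).sub
      ((cρ.mul cu).inv₀ (mul_ne_zero hρ0 hu0))).mul_const _
  have hφ1 : |G.φ (G.temp (U z))| < |G.φ (G.temp W)| + 1 := by
    rw [hW]
    exact lt_add_one _
  rw [← hW] at k1 k2 k3 k4
  filter_upwards [cp.eventually (lt_mem_nhds k1),
    cρ.eventually (lt_mem_nhds k2),
    (cρ.mul cu).eventually (lt_mem_nhds k3),
    cs.eventually (lt_mem_nhds k4),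
    cφ.eventually (gt_mem_nhds hφ1)]
    with w w1 w2 w3 w4 w5
  exact ⟨w1.le, w2.le, w3.le, w4.le, w5.le⟩

/-- A property that holds near each point of a section holds on a strip to its right. -/
theorem eventually_section {a b x₀ : ℝ} {f g : ℝ → ℝ} (hf : ContinuousOn f (Ico a b))
    (hg : ContinuousOn g (Ico a b)) (hfg : ∀ x ∈ Ico a b, f x < g x) (hx₀ : x₀ ∈ Ico a b)
    {P : ℝ × ℝ → Prop} (hP : ∀ y ∈ Icc (f x₀) (g x₀),
      ∀ᶠ w in nhdsWithin (x₀, y) (closedStrip a b f g), P w) :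
    ∃ x₁ ∈ Ioc x₀ b, ∀ z ∈ closedStrip x₀ x₁ f g, P z := by
  have hev : ∀ᶠ x in nhds x₀, ∀ s ∈ Icc (0 : ℝ) 1,
      x ∈ Ico a b → s ∈ Icc (0 : ℝ) 1 → P (x, level f g x s) := by
    -- Tube lemma over the compact interval of levels: the property near each (x₀, s) becomes
    -- uniform in s. Membership in the domain is a premise because x ranges over a full
    -- neighbourhood of x₀, which may leave `Ico a b`.
    refine isCompact_Icc.eventually_forall_of_forall_eventually
      (P := fun x s => x ∈ Ico a b → s ∈ Icc (0 : ℝ) 1 → P (x, level f g x s)) fun s hs => ?_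
    have hc := continuousOn_level hf hg (x₀, s) ⟨hx₀, hs⟩
    have ht := tendsto_nhdsWithin_of_tendsto_nhds_of_eventually_within _ hc
      (s := closedStrip a b f g) (eventually_nhdsWithin_of_forall fun z hz =>
        level_mem_closedStrip hz.1 (hfg _ hz.1) hz.2)
    have hm := level_mem_closedStrip hx₀ (hfg _ hx₀) hs
    have h2 := ht.eventually (hP _ ⟨hm.2.2.1, hm.2.2.2⟩)
    rw [eventually_nhdsWithin_iff] at h2
    filter_upwards [h2] with z hz h3 h4
    exact hz ⟨h3, h4⟩
  obtain ⟨l, x₁, ⟨hl, h1⟩, h2⟩ := mem_nhds_iff_exists_Ioo_subset.1 hev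
  refine ⟨min x₁ b, ⟨lt_min h1 hx₀.2, min_le_right _ _⟩, fun z hz => ?_⟩
  obtain ⟨z1, z2, z3, z4⟩ := hz
  have hzI : z.1 ∈ Ico a b := ⟨hx₀.1.trans z1, z2.trans_le (min_le_right _ _)⟩
  obtain ⟨s, hs, hsz⟩ := exists_level_eq (hfg _ hzI) ⟨z3, z4⟩
  have h3 := h2 (a := z.1) ⟨hl.trans_le z1, z2.trans_le (min_le_left _ _)⟩ s hs hzI hs
  rwa [hsz] at h3

/-- A bounded `C¹` solution with uniformly nondegenerate states. -/
structure Gas.IsRegularLayer (G : Gas) (κ K a b : ℝ) (f g : ℝ → ℝ) (U : ℝ × ℝ → FlowState) :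
    Prop where
  lower : IsCurve a b f
  upper : IsCurve a b g
  lt : ∀ x ∈ Ico a b, f x < g x
  u : IsC1Bdd (strip a b f g) (fun z => (U z).u)
  v : IsC1Bdd (strip a b f g) (fun z => (U z).v)
  p : IsC1Bdd (strip a b f g) (fun z => (U z).p)
  ρ : IsC1Bdd (strip a b f g) (fun z => (U z).ρ)
  Y : IsC1Bdd (strip a b f g) (fun z => (U z).Y)
  trace : ContinuousFlowOn U (closedStrip a b f g)
  euler : ∀ z ∈ strip a b f g, G.EulerAt U z
  pos : 0 < κ
  nondegenerate : ∀ z ∈ closedStrip a b f g, G.Nondegenerate κ K (U z)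

namespace Gas.IsRegularLayer

variable {G : Gas} {κ K a b : ℝ} {f g : ℝ → ℝ} {U : ℝ × ℝ → FlowState}

theorem mono (h : G.IsRegularLayer κ K a b f g U) {b' : ℝ} (hb : b' ≤ b) :
    G.IsRegularLayer κ K a b' f g U := by
  have h1 : strip a b' f g ⊆ strip a b f g := fun z hz => ⟨hz.1, hz.2.1.trans_le hb, hz.2.2⟩
  have h2 : closedStrip a b' f g ⊆ closedStrip a b f g :=
    fun z hz => ⟨hz.1, hz.2.1.trans_le hb, hz.2.2⟩
  exact ⟨h.lower.mono le_rfl hb, h.upper.mono le_rfl hb, fun x hx => h.lt x ⟨hx.1, hx.2.trans_le hb⟩,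
    h.u.mono h1, h.v.mono h1, h.p.mono h1, h.ρ.mono h1, h.Y.mono h1, h.trace.mono h2,
    fun z hz => h.euler z (h1 hz), h.pos, fun z hz => h.nondegenerate z (h2 hz)⟩

theorem isOpen (h : G.IsRegularLayer κ K a b f g U) : IsOpen (strip a b f g) :=
  isOpen_strip h.lower.cont h.upper.cont

theorem continuousOn_enthalpy (h : G.IsRegularLayer κ K a b f g U) :
    ContinuousOn (fun z => G.enthalpy (U z)) (closedStrip a b f g) := by
  obtain ⟨cu, cv, cp, cρ, cY⟩ := h.trace
  have hρ : ∀ z ∈ closedStrip a b f g, (U z).ρ ≠ 0 :=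
    fun z hz => (h.pos.trans_le (h.nondegenerate z hz).ρ).ne'
  have cT : ContinuousOn (fun z => (U z).p / (G.R * (U z).ρ)) (closedStrip a b f g) :=
    cp.div (continuousOn_const.mul cρ) fun z hz => mul_ne_zero G.R_pos.ne' (hρ z hz)
  exact (((((cu.pow 2).add (cv.pow 2)).div_const 2).add (continuousOn_const.mul cT)).add
    (continuousOn_const.mul cY)).add (cp.div cρ hρ)

theorem continuousOn_relEnergy (h : G.IsRegularLayer κ K a b f g U) (W : FlowState) :
    ContinuousOn (fun z => G.relEnergy W (U z)) (closedStrip a b f g) := by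
  have cH := h.continuousOn_enthalpy
  obtain ⟨cu, cv, cp, cρ, cY⟩ := h.trace
  have cw : ContinuousOn (fun z => (U z).u / (G.γ * (U z).p)) (closedStrip a b f g) :=
    cu.div (continuousOn_const.mul cp) fun z hz =>
      mul_ne_zero G.γ_pos.ne' (h.pos.trans_le (h.nondegenerate z hz).p).ne'
  unfold relEnergy
  fun_prop

theorem continuousOn_relFlux (h : G.IsRegularLayer κ K a b f g U) (W : FlowState) :
    ContinuousOn (fun z => G.relFlux W (U z)) (closedStrip a b f g) := by
  have cH := h.continuousOn_enthalpy
  obtain ⟨cu, cv, cp, cρ, cY⟩ := h.trace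
  have cw : ContinuousOn (fun z => (U z).v / (G.γ * (U z).p)) (closedStrip a b f g) :=
    cv.div (continuousOn_const.mul cp) fun z hz =>
      mul_ne_zero G.γ_pos.ne' (h.pos.trans_le (h.nondegenerate z hz).p).ne'
  unfold relFlux
  fun_prop

theorem le_of_mem_strip (h : G.IsRegularLayer κ K a b f g U) {z : ℝ × ℝ}
    (hz : z ∈ strip a b f g) : G.Nondegenerate κ K (U z) :=
  h.nondegenerate z (strip_subset_closedStrip _ _ _ _ hz)

theorem isC1Bdd_enthalpy (h : G.IsRegularLayer κ K a b f g U) :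
    IsC1Bdd (strip a b f g) (fun z => G.enthalpy (U z)) := by
  have hΩ := h.isOpen
  have cT : IsC1Bdd (strip a b f g) (fun z => (U z).p / (G.R * (U z).ρ)) :=
    h.p.div ((IsC1Bdd.const G.R).mul h.ρ hΩ) hΩ (mul_pos G.R_pos h.pos) fun _ hz =>
      mul_le_mul_of_nonneg_left (h.le_of_mem_strip hz).ρ G.R_pos.le
  exact (((((h.u.sq hΩ).add (h.v.sq hΩ) hΩ).div (IsC1Bdd.const 2) hΩ two_pos
    fun _ _ => le_rfl).add ((IsC1Bdd.const G.cv).mul cT hΩ) hΩ).add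
    ((IsC1Bdd.const G.q0).mul h.Y hΩ) hΩ).add
    (h.p.div h.ρ hΩ h.pos fun _ hz => (h.le_of_mem_strip hz).ρ) hΩ

theorem isC1Bdd_div (h : G.IsRegularLayer κ K a b f g U) {F : ℝ × ℝ → ℝ}
    (hF : IsC1Bdd (strip a b f g) F) :
    IsC1Bdd (strip a b f g) (fun z => F z / (G.γ * (U z).p)) :=
  hF.div ((IsC1Bdd.const G.γ).mul h.p h.isOpen) h.isOpen (mul_pos G.γ_pos h.pos) fun _ hz =>
    mul_le_mul_of_nonneg_left (h.le_of_mem_strip hz).p G.γ_pos.le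

theorem isC1Bdd_weight (h : G.IsRegularLayer κ K a b f g U) (W : FlowState) :
    IsC1Bdd (strip a b f g) (fun z => (((U z).u - W.u) ^ 2 + (U z).v ^ 2) * 2⁻¹ + (U z).Y ^ 2
      + (G.enthalpy (U z) - G.enthalpy W) ^ 2) := by
  have hΩ := h.isOpen
  exact ((((((h.u.sub (.const _) hΩ).sq hΩ).add (h.v.sq hΩ) hΩ).mul (.const _) hΩ).add
    (h.Y.sq hΩ) hΩ).add ((h.isC1Bdd_enthalpy.sub (.const _) hΩ).sq hΩ) hΩ)

theorem isC1Bdd_relEnergy (h : G.IsRegularLayer κ K a b f g U) (W : FlowState) :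
    IsC1Bdd (strip a b f g) (fun z => G.relEnergy W (U z)) := by
  have hΩ := h.isOpen
  have hP := h.p.sub (.const W.p) hΩ
  exact (((h.ρ.mul h.u hΩ).mul (h.isC1Bdd_weight W) hΩ).add
    ((h.u.sub (.const _) hΩ).mul hP hΩ) hΩ).add
    ((h.isC1Bdd_div h.u).mul ((hP.sq hΩ).mul (.const _) hΩ) hΩ) hΩ

theorem isC1Bdd_relFlux (h : G.IsRegularLayer κ K a b f g U) (W : FlowState) :
    IsC1Bdd (strip a b f g) (fun z => G.relFlux W (U z)) := by
  have hΩ := h.isOpen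
  have hP := h.p.sub (.const W.p) hΩ
  exact (((h.ρ.mul h.v hΩ).mul (h.isC1Bdd_weight W) hΩ).add (h.v.mul hP hΩ) hΩ).add
    ((h.isC1Bdd_div h.v).mul ((hP.sq hΩ).mul (.const _) hΩ) hΩ) hΩ

/-- The production of the relative energy is bounded by the relative energy. -/
theorem exists_production_le (h : G.IsRegularLayer κ K a b f g U) (W : FlowState) :
    ∃ M, ∀ z ∈ strip a b f g, dx (fun w => G.relEnergy W (U w)) z
      + dy (fun w => G.relFlux W (U w)) z ≤ M * G.relEnergy W (U z) := by
  have hΩ := h.isOpen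
  obtain ⟨C, hC⟩ := h.ρ.2
  obtain ⟨A, hA⟩ := (h.isC1Bdd_div h.u).2
  obtain ⟨B, hB⟩ := (h.isC1Bdd_div h.v).2
  have hk : 0 < (G.cv / G.R)⁻¹ * G.q0 :=
    mul_pos (inv_pos.2 (div_pos G.cv_pos G.R_pos)) G.q0_pos
  set m := (G.cv / G.R)⁻¹ * G.q0 * (C * K) * (G.γ * κ)⁻¹ with hm
  -- The three summands bound the coefficients of Y(p - W.p), of Y², and of (p - W.p)² from the
  -- derivatives of the weights. The factor κ⁻¹ passes from (p - W.p)² + Y² to the energy.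
  refine ⟨(m + 2 * (C * K) + (A + B)) * κ⁻¹, fun z hz => ?_⟩
  have hn := h.le_of_mem_strip hz
  have hp0 : 0 < (U z).p := h.pos.trans_le hn.p
  have hρ0 : 0 < (U z).ρ := h.pos.trans_le hn.ρ
  have hγ := G.γ_pos
  have hκ := h.pos
  rw [G.relEnergy_balance W (h.u.differentiableAt hΩ hz) (h.v.differentiableAt hΩ hz)
    (h.p.differentiableAt hΩ hz) (h.ρ.differentiableAt hΩ hz) (h.Y.differentiableAt hΩ hz)
    hp0.ne' hρ0.ne' (h.euler z hz)]
  have hC1 := (hC z hz).1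
  have hC0 : 0 ≤ C := (abs_nonneg _).trans hC1
  have hK0 : 0 ≤ K := (abs_nonneg _).trans hn.rate
  have hA1 := (hA z hz).2.1
  have hB1 := (hB z hz).2.2
  have hA0 := (abs_nonneg _).trans hA1
  have hB0 := (abs_nonneg _).trans hB1
  have hsq := hn.sq_add_sq_le (W := W) h.pos
  set P := (U z).p - W.p
  set Y := (U z).Y
  set a := dx (fun w => (U w).u / (G.γ * (U w).p)) z
  set b := dy (fun w => (U w).v / (G.γ * (U w).p)) z
  have hρφ : |(U z).ρ * G.φ (G.temp (U z))| ≤ C * K := by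
    rw [abs_mul]
    exact mul_le_mul hC1 hn.rate (abs_nonneg _) hC0
  have hcoef : |(G.cv / G.R)⁻¹ * G.q0 * ((U z).ρ * G.φ (G.temp (U z))) * (G.γ * (U z).p)⁻¹|
      ≤ m := by
    rw [abs_mul, abs_mul, abs_of_pos hk, abs_of_pos (inv_pos.2 (mul_pos hγ hp0)), hm]
    have h1 : (G.γ * (U z).p)⁻¹ ≤ (G.γ * κ)⁻¹ :=
      inv_anti₀ (mul_pos hγ h.pos) (mul_le_mul_of_nonneg_left hn.p hγ.le)
    exact mul_le_mul (mul_le_mul_of_nonneg_left hρφ hk.le) h1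
      (inv_pos.2 (mul_pos hγ hp0)).le (by positivity)
  have hm0 := (abs_nonneg _).trans hcoef
  set c := (G.cv / G.R)⁻¹ * G.q0 * ((U z).ρ * G.φ (G.temp (U z))) * (G.γ * (U z).p)⁻¹ with hc
  set r := (U z).ρ * G.φ (G.temp (U z)) with hr
  have h1 : c * (Y * P) ≤ m * (P ^ 2 + Y ^ 2) := by
    refine (le_abs_self _).trans ?_
    rw [abs_mul]
    refine mul_le_mul hcoef ?_ (abs_nonneg _) hm0
    rw [abs_le]
    constructor <;> nlinarith [sq_nonneg (P - Y), sq_nonneg (P + Y), sq_nonneg P, sq_nonneg Y]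
  have h2 : -(2 * r * Y ^ 2) ≤ 2 * (C * K) * (P ^ 2 + Y ^ 2) := by
    nlinarith [neg_le_of_abs_le hρφ, sq_nonneg P, sq_nonneg Y, mul_nonneg hC0 hK0,
      mul_nonneg (mul_nonneg hC0 hK0) (sq_nonneg P)]
  have h3 : (a + b) * 2⁻¹ * P ^ 2 ≤ (A + B) * (P ^ 2 + Y ^ 2) := by
    have h4 : (a + b) * 2⁻¹ ≤ A + B := by
      linarith [le_of_abs_le hA1, le_of_abs_le hB1]
    have := mul_le_mul_of_nonneg_right h4 (sq_nonneg P)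
    nlinarith [mul_nonneg (add_nonneg hA0 hB0) (sq_nonneg Y)]
  have h5 : (m + 2 * (C * K) + (A + B)) * (P ^ 2 + Y ^ 2)
      ≤ (m + 2 * (C * K) + (A + B)) * (κ⁻¹ * G.relEnergy W (U z)) :=
    mul_le_mul_of_nonneg_left hsq (by positivity)
  have h6 : (G.cv / G.R)⁻¹ * G.q0 * (U z).ρ * G.φ (G.temp (U z)) * (G.γ * (U z).p)⁻¹ = c := by
    rw [hc, hr]
    ring
  have h7 : 2 * (U z).ρ * G.φ (G.temp (U z)) = 2 * r := by
    rw [hr]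
    ring
  rw [h6, h7]
  linarith

/-- The energy inequality in a layer bounded by slip curves. -/
theorem exists_energy_le (h : G.IsRegularLayer κ K a b f g U) (W : FlowState)
    (hf : ∀ x ∈ Ioo a b, normalVelocity (U (x, f x)) (deriv f x) = 0)
    (hg : ∀ x ∈ Ioo a b, normalVelocity (U (x, g x)) (deriv g x) = 0) :
    ∃ M, ∃ E' : ℝ → ℝ, ∀ x ∈ Ioo a b,
      HasDerivAt (sectionIntegral f g fun z => G.relEnergy W (U z)) (E' x) x ∧
      E' x ≤ M * sectionIntegral f g (fun z => G.relEnergy W (U z)) x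
        - deriv g x * W.u * ((U (x, g x)).p - W.p) + deriv f x * W.u * ((U (x, f x)).p - W.p) := by
  obtain ⟨M, hM⟩ := h.exists_production_le W
  -- The function E' is the derivative given by Reynolds' theorem, filled in by unification.
  refine ⟨M, _, fun x hx => ⟨hasDerivAt_sectionIntegral h.lower h.upper h.lt
    (h.isC1Bdd_relEnergy W) (h.continuousOn_relEnergy W) (h.isC1Bdd_relFlux W)
    (h.continuousOn_relFlux W) hx, ?_⟩⟩
  rw [G.relFlux_sub_of_slip W _ (hf x hx), G.relFlux_sub_of_slip W _ (hg x hx)]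
  have := sectionIntegral_production_le h.lower h.upper h.lt
    (h.isC1Bdd_relEnergy W) (h.continuousOn_relEnergy W) (h.isC1Bdd_relFlux W) hM hx
  linarith

end Gas.IsRegularLayer

/-! ## Propagation of uniform sections -/

/-- The flow `U` is in the state `W` on the closed section over `x`. -/
def IsUniformSection (f g : ℝ → ℝ) (U : ℝ × ℝ → FlowState) (W : FlowState) (x : ℝ) : Prop :=
  ∀ y ∈ Icc (f x) (g x), U (x, y) = W

theorem Gas.isSupersonic_uniformState {G : Gas} {u p ρ : ℝ} (hρ : 0 < ρ)
    (hlaw : G.StateLaw (uniformState u p ρ)) (hu : G.sonic (uniformState u p ρ) < u) :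
    G.IsSupersonic (uniformState u p ρ) := by
  have hp : 0 < p := (G.stateLaw_iff (uniformState u p ρ) hρ).1 hlaw
  have hu0 : 0 < u := (Real.sqrt_nonneg _).trans_lt hu
  refine ⟨hp, hρ, hu0, ?_⟩
  have h1 := (Real.sqrt_lt' hu0).1 hu
  simp only [uniformState] at h1 ⊢
  rw [div_lt_iff₀ hρ] at h1
  linarith

theorem IsC2Alpha.isCurve {α L : ℝ} {g : ℝ → ℝ} (h : IsC2Alpha α L g) :
    IsCurve 0 L g where
  cont := h.1.continuousOn
  diff := fun _ hx => (h.1.differentiableOn two_ne_zero).differentiableAt (Ico_mem_nhds hx.1 hx.2)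
  slope := by
    obtain ⟨C, hC, -⟩ := h.2
    refine ⟨C, fun x hx => ?_⟩
    have h1 := hC 1 one_le_two x (Ioo_subset_Ico_self hx)
    rwa [iteratedDerivWithin_one, derivWithin_of_mem_nhds (Ico_mem_nhds hx.1 hx.2)] at h1

theorem isCurve_const (a b c : ℝ) : IsCurve a b fun _ => c :=
  ⟨continuousOn_const, fun _ _ => differentiableAt_const c, 0, fun x _ => by simp⟩

/-- The Mach number bounds the speed, not its component along x. The uniform bounds with u > c come
instead from closeness to W: they hold near every point of the uniform section, and compactness of
the section gives a whole strip to its right. -/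
theorem Gas.IsLayerFlow.exists_isRegularLayer {G : Gas} {α L x₀ : ℝ} {f g : ℝ → ℝ}
    {U : ℝ × ℝ → FlowState} {W : FlowState} (h : G.IsLayerFlow α L f g U)
    (hφ : ContinuousOn G.φ (Ioi 0)) (hW : G.IsSupersonic W) (hf : IsCurve 0 L f)
    (hg : IsCurve 0 L g) (hfg : ∀ x ∈ Ico 0 L, f x < g x) (hx₀ : x₀ ∈ Ico 0 L)
    (hU : IsUniformSection f g U W x₀) :
    ∃ x₁ ∈ Ioc x₀ L, ∃ κ K, G.IsRegularLayer κ K x₀ x₁ f g U := by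
  obtain ⟨κ, hκ, K, hnear⟩ := hW.eventually_nondegenerate hφ
  obtain ⟨x₁, hx₁, h1⟩ := eventually_section hf.cont hg.cont hfg hx₀
    (P := fun z => G.Nondegenerate κ K (U z)) fun y hy =>
      hnear U _ h.trace (x₀, y) ⟨hx₀.1, hx₀.2, hy.1, hy.2⟩ (hU y hy)
  have hs : strip x₀ x₁ f g ⊆ region L f g :=
    fun z hz => ⟨hx₀.1.trans_lt hz.1, hz.2.1.trans_le hx₁.2, hz.2.2⟩
  have hs' : closedStrip x₀ x₁ f g ⊆ regionWithBoundary L f g :=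
    fun z hz => ⟨hx₀.1.trans hz.1, hz.2.1.trans_le hx₁.2, hz.2.2⟩
  obtain ⟨su, sv, sp, sρ, sY⟩ := h.smooth
  exact ⟨x₁, hx₁, κ, K, hf.mono hx₀.1 hx₁.2, hg.mono hx₀.1 hx₁.2,
    fun x hx => hfg x ⟨hx₀.1.trans hx.1, hx.2.trans_le hx₁.2⟩,
    su.isC1Bdd.mono hs, sv.isC1Bdd.mono hs, sp.isC1Bdd.mono hs, sρ.isC1Bdd.mono hs,
    sY.isC1Bdd.mono hs, h.trace.mono hs', fun z hz => h.euler z (hs hz), hκ, h1⟩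

theorem sectionIntegral_eq_zero {f g : ℝ → ℝ} {Q : ℝ × ℝ → ℝ} {x : ℝ} (hfg : f x < g x)
    (h : ∀ y ∈ Icc (f x) (g x), Q (x, y) = 0) : sectionIntegral f g Q x = 0 := by
  rw [sectionIntegral, intervalIntegral.integral_congr (g := fun _ => (0 : ℝ)) fun s hs => ?_]
  · simp
  · rw [uIcc_of_le zero_le_one] at hs
    obtain ⟨-, -, h1, h2⟩ := level_mem_closedStrip (a := x) (b := x + 1)
      ⟨le_rfl, lt_add_one x⟩ hfg hs
    simp only [h _ ⟨h1, h2⟩, mul_zero]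

theorem Gas.relEnergy_uniformState_self (G : Gas) (u p ρ : ℝ) :
    G.relEnergy (uniformState u p ρ) (uniformState u p ρ) = 0 := by
  simp [relEnergy, uniformState]

/-- Two regular layers separated by a contact discontinuity and starting from uniform states of
equal pressure are uniform. -/
theorem Gas.IsRegularLayer.isUniformSection {G : Gas} {κp Kp κm Km a b up ρp um ρm p : ℝ}
    {f g h : ℝ → ℝ} {Um Up : ℝ × ℝ → FlowState} (hrp : G.IsRegularLayer κp Kp a b g h Up)
    (hrm : G.IsRegularLayer κm Km a b f g Um)
    (hWp : G.IsSupersonic (uniformState up p ρp)) (hWm : G.IsSupersonic (uniformState um p ρm))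
    (hf' : ∀ x ∈ Ioo a b, deriv f x = 0) (hh' : ∀ x ∈ Ioo a b, deriv h x = 0)
    (hf : ∀ x ∈ Ioo a b, normalVelocity (Um (x, f x)) (deriv f x) = 0)
    (hgm : ∀ x ∈ Ioo a b, normalVelocity (Um (x, g x)) (deriv g x) = 0)
    (hgp : ∀ x ∈ Ioo a b, normalVelocity (Up (x, g x)) (deriv g x) = 0)
    (hh : ∀ x ∈ Ioo a b, normalVelocity (Up (x, h x)) (deriv h x) = 0)
    (hpr : ∀ x ∈ Ioo a b, (Up (x, g x)).p = (Um (x, g x)).p)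
    (hp0 : IsUniformSection g h Up (uniformState up p ρp) a)
    (hm0 : IsUniformSection f g Um (uniformState um p ρm) a) {x : ℝ} (hx : x ∈ Ico a b) :
    IsUniformSection g h Up (uniformState up p ρp) x ∧
      IsUniformSection f g Um (uniformState um p ρm) x := by
  set Wp := uniformState up p ρp with hWp'
  set Wm := uniformState um p ρm with hWm'
  obtain ⟨Mp, Ep', hEp⟩ := hrp.exists_energy_le Wp hgp hh
  obtain ⟨Mm, Em', hEm⟩ := hrm.exists_energy_le Wm hf hgm
  set Ep := sectionIntegral g h fun z => G.relEnergy Wp (Up z) with hEp_def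
  set Em := sectionIntegral f g fun z => G.relEnergy Wm (Um z) with hEm_def
  have qp : ∀ z ∈ closedStrip a b g h, 0 ≤ G.relEnergy Wp (Up z) :=
    fun z hz => (hrp.nondegenerate z hz).relEnergy_nonneg hrp.pos
  have qm : ∀ z ∈ closedStrip a b f g, 0 ≤ G.relEnergy Wm (Um z) :=
    fun z hz => (hrm.nondegenerate z hz).relEnergy_nonneg hrm.pos
  have hEp0 : ∀ x ∈ Ico a b, 0 ≤ Ep x := fun x hx => sectionIntegral_nonneg hrp.lt qp hx
  have hEm0 : ∀ x ∈ Ico a b, 0 ≤ Em x := fun x hx => sectionIntegral_nonneg hrm.lt qm hx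
  have ip : 0 < up⁻¹ := inv_pos.2 hWp.u
  have im : 0 < um⁻¹ := inv_pos.2 hWm.u
  have ha : a ∈ Ico a b := ⟨le_rfl, hx.1.trans_lt hx.2⟩
  have hEpa : Ep a = 0 := sectionIntegral_eq_zero (hrp.lt a ha) fun y hy => by
    rw [hp0 y hy]
    exact G.relEnergy_uniformState_self _ _ _
  have hEma : Em a = 0 := sectionIntegral_eq_zero (hrm.lt a ha) fun y hy => by
    rw [hm0 y hy]
    exact G.relEnergy_uniformState_self _ _ _
  -- The weights are the reciprocals of the background velocities, which makes the two fluxes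
  -- through the contact curve opposite.
  have hle : up⁻¹ * Ep x + um⁻¹ * Em x ≤ 0 := by
    refine nonpos_of_deriv_le_mul (K := max Mp Mm)
      (E := fun x => up⁻¹ * Ep x + um⁻¹ * Em x)
      (E' := fun x => up⁻¹ * Ep' x + um⁻¹ * Em' x) ?_ (fun t ht => ?_) (fun t ht => ?_) ?_ hx
    · exact (continuousOn_const.mul (continuousOn_sectionIntegral hrp.lower.cont hrp.upper.cont
        hrp.lt (hrp.continuousOn_relEnergy Wp))).add
        (continuousOn_const.mul (continuousOn_sectionIntegral hrm.lower.cont hrm.upper.cont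
        hrm.lt (hrm.continuousOn_relEnergy Wm)))
    · exact ((hEp t ht).1.const_mul _).add ((hEm t ht).1.const_mul _)
    · have h1 := (hEp t ht).2
      have h2 := (hEm t ht).2
      rw [hh' t ht, hpr t ht] at h1
      rw [hf' t ht] at h2
      have h3 := hEp0 t (Ioo_subset_Ico_self ht)
      have h4 := hEm0 t (Ioo_subset_Ico_self ht)
      set P := (Um (t, g t)).p
      have e1 : up⁻¹ * up = 1 := inv_mul_cancel₀ hWp.u.ne'
      have e2 : um⁻¹ * um = 1 := inv_mul_cancel₀ hWm.u.ne'
      -- Nonnegativity of the energy allows `Mp` to be replaced by the maximum. The remaining term,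
      -- slope times P - p, reappears with the opposite sign in `h5'`.
      have h5 : up⁻¹ * Ep' t ≤ max Mp Mm * (up⁻¹ * Ep t) + deriv g t * (P - p) := by
        have h6 := mul_le_mul_of_nonneg_left h1 ip.le
        have h7 := mul_le_mul_of_nonneg_right (le_max_left Mp Mm) (mul_nonneg ip.le h3)
        have h8 : up⁻¹ * (Mp * Ep t - 0 * Wp.u * ((Up (t, h t)).p - Wp.p)
            + deriv g t * Wp.u * (P - Wp.p)) = Mp * (up⁻¹ * Ep t) + deriv g t * (P - p) := by
          simp only [hWp', uniformState]
          linear_combination deriv g t * (P - p) * e1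
        linarith
      have h5' : um⁻¹ * Em' t ≤ max Mp Mm * (um⁻¹ * Em t) - deriv g t * (P - p) := by
        have h6 := mul_le_mul_of_nonneg_left h2 im.le
        have h7 := mul_le_mul_of_nonneg_right (le_max_right Mp Mm) (mul_nonneg im.le h4)
        have h8 : um⁻¹ * (Mm * Em t - deriv g t * Wm.u * (P - Wm.p)
            + 0 * Wm.u * ((Um (t, f t)).p - Wm.p)) = Mm * (um⁻¹ * Em t) - deriv g t * (P - p) := by
          simp only [hWm', uniformState]
          linear_combination -(deriv g t * (P - p)) * e2
        linarith
      linarith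
    · simp [hEpa, hEma]
  have hp1 := mul_nonneg ip.le (hEp0 x hx)
  have hm1 := mul_nonneg im.le (hEm0 x hx)
  have hp2 : Ep x ≤ 0 := nonpos_of_mul_nonpos_right (by linarith : up⁻¹ * Ep x ≤ 0) ip
  have hm2 : Em x ≤ 0 := nonpos_of_mul_nonpos_right (by linarith : um⁻¹ * Em x ≤ 0) im
  constructor
  · exact fun y hy => (hrp.nondegenerate (x, y) ⟨hx.1, hx.2, hy.1, hy.2⟩).eq_of_relEnergy_eq_zero
      hrp.pos hWp.p hWp.ρ (eq_zero_of_sectionIntegral_nonpos hrp.lt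
        (hrp.continuousOn_relEnergy Wp) qp hx hp2 hy)
  · exact fun y hy => (hrm.nondegenerate (x, y) ⟨hx.1, hx.2, hy.1, hy.2⟩).eq_of_relEnergy_eq_zero
      hrm.pos hWm.p hWm.ρ (eq_zero_of_sectionIntegral_nonpos hrm.lt
        (hrm.continuousOn_relEnergy Wm) qm hx hm2 hy)

/-- `FlowState` carries no topology, so the limit is taken in each component separately, along the
path γ. -/
theorem ContinuousFlowOn.eqOn_closure {U : ℝ × ℝ → FlowState} {S : Set (ℝ × ℝ)} {W : FlowState}
    (h : ContinuousFlowOn U S) {γ : ℝ → ℝ × ℝ} {I J : Set ℝ} (hγ : ContinuousOn γ I)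
    (hS : MapsTo γ I S) (hJ : J ⊆ I) (hW : ∀ t ∈ J, U (γ t) = W) {t : ℝ} (ht : t ∈ I)
    (htJ : t ∈ closure J) : U (γ t) = W := by
  have key : ∀ π : FlowState → ℝ, ContinuousOn (fun z => π (U z)) S → π (U (γ t)) = π W := by
    intro π hπ
    have h1 : ContinuousOn (fun t => π (U (γ t))) I := hπ.comp hγ hS
    have h2 := ((h1 t ht).mono hJ).mem_closure_image htJ
    have h3 : (fun t => π (U (γ t))) '' J ⊆ {π W} := by
      rintro _ ⟨s, hs, rfl⟩
      simp [hW s hs]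
    have h4 := closure_mono h3 h2
    rwa [closure_singleton] at h4
  exact FlowState.ext (key _ h.1) (key _ h.2.1) (key _ h.2.2.1) (key _ h.2.2.2.1)
    (key _ h.2.2.2.2)

/-- The set of uniform sections is closed. -/
theorem isUniformSection_of_mem_closure {L : ℝ} {f g : ℝ → ℝ} {U : ℝ × ℝ → FlowState}
    {W : FlowState} (hU : ContinuousFlowOn U (regionWithBoundary L f g))
    (hf : ContinuousOn f (Ico 0 L)) (hg : ContinuousOn g (Ico 0 L))
    (hfg : ∀ x ∈ Ico 0 L, f x < g x) {J : Set ℝ} (hJ : J ⊆ Ico 0 L)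
    (hW : ∀ x ∈ J, IsUniformSection f g U W x) {x : ℝ} (hx : x ∈ Ico 0 L) (hxJ : x ∈ closure J) :
    IsUniformSection f g U W x := by
  intro y hy
  obtain ⟨s, hs, rfl⟩ := exists_level_eq (hfg x hx) hy
  refine hU.eqOn_closure (γ := fun x => (x, level f g x s)) (I := Ico 0 L) (J := J) ?_ ?_ hJ ?_
    hx hxJ
  · exact (continuousOn_level hf hg).comp (f := fun x => (x, s))
      (by fun_prop) fun t ht => ⟨ht, hs⟩
  · exact fun t ht => level_mem_closedStrip ht (hfg t ht) hs
  · intro t ht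
    obtain ⟨-, -, h1, h2⟩ := level_mem_closedStrip (hJ ht) (hfg t (hJ ht)) hs
    exact hW t ht _ ⟨h1, h2⟩

/-- A layer flow whose trace on the open inlet is uniform has a uniform inlet section. -/
theorem isUniformSection_inlet {L : ℝ} {f g : ℝ → ℝ} {U : ℝ × ℝ → FlowState}
    {W : FlowState} (hL : 0 < L) (hU : ContinuousFlowOn U (regionWithBoundary L f g))
    (hfg : f 0 < g 0) (hW : ∀ y ∈ Ioo (f 0) (g 0), U (0, y) = W) : IsUniformSection f g U W 0 :=
  fun y hy => hU.eqOn_closure (γ := fun y => (0, y)) (I := Icc (f 0) (g 0))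
    (J := Ioo (f 0) (g 0)) (by fun_prop) (fun t ht => ⟨le_rfl, hL, ht.1, ht.2⟩)
    Ioo_subset_Icc_self hW hy (by rwa [closure_Ioo hfg.ne])

/-- The contact discontinuity solution with uniform supersonic inlet states of equal pressure in a
straight nozzle has only uniform sections. -/
theorem Gas.IsContactSolution.isUniformSection {G : Gas} {α L cm cp up ρp um ρm p : ℝ}
    {Um Up : ℝ × ℝ → FlowState} {g : ℝ → ℝ} (hL : 0 < L) (hφ : ContinuousOn G.φ (Ioi 0))
    (hWp : G.IsSupersonic (uniformState up p ρp)) (hWm : G.IsSupersonic (uniformState um p ρm))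
    (h : G.IsContactSolution α L (fun _ => cm) (fun _ => cp) (fun _ => uniformState um p ρm)
      (fun _ => uniformState up p ρp) Um Up g) (hg : IsCurve 0 L g) {x : ℝ} (hx : x ∈ Ico 0 L) :
    IsUniformSection g (fun _ => cp) Up (uniformState up p ρp) x ∧
      IsUniformSection (fun _ => cm) g Um (uniformState um p ρm) x := by
  have hc : ∀ c, IsCurve 0 L fun _ => c := isCurve_const 0 L
  have hlt1 : ∀ x ∈ Ico 0 L, g x < cp := fun x hx => (h.gcd_mem x hx).2
  have hlt2 : ∀ x ∈ Ico 0 L, cm < g x := fun x hx => (h.gcd_mem x hx).1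
  have h0 : (0 : ℝ) ∈ Ico 0 L := ⟨le_rfl, hL⟩
  let S : Set ℝ := {x | IsUniformSection g (fun _ => cp) Up (uniformState up p ρp) x ∧
      IsUniformSection (fun _ => cm) g Um (uniformState um p ρm) x}
  have hsub : Icc 0 x ⊆ Ico 0 L := fun t ht => ⟨ht.1, ht.2.trans_lt hx.2⟩
  suffices Icc 0 x ⊆ S from this ⟨hx.1, le_rfl⟩
  -- Continuous induction on [0, x]: the uniform sections form a closed set, it contains 0, and to
  -- the right of each of its points t < x it has further points arbitrarily close to t.
  refine IsClosed.Icc_subset_of_forall_exists_gt ?_ ⟨?_, ?_⟩ ?_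
  · refine isClosed_of_closure_subset fun t ht => ?_
    have htI : t ∈ Icc 0 x := closure_minimal inter_subset_right isClosed_Icc ht
    exact ⟨⟨isUniformSection_of_mem_closure h.upper.trace hg.cont (hc cp).cont hlt1
      (fun s hs => hsub hs.2) (fun s hs => hs.1.1) (hsub htI) ht,
      isUniformSection_of_mem_closure h.lower.trace (hc cm).cont hg.cont hlt2
      (fun s hs => hsub hs.2) (fun s hs => hs.1.2) (hsub htI) ht⟩, htI⟩
  · refine isUniformSection_inlet hL h.upper.trace (hlt1 0 h0) fun y hy => h.upper_inlet y ?_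
    rwa [h.gcd_zero] at hy
  · refine isUniformSection_inlet hL h.lower.trace (hlt2 0 h0) fun y hy => h.lower_inlet y ?_
    rwa [h.gcd_zero] at hy
  · rintro t ⟨⟨htp, htm⟩, ht⟩ s hs
    have htL : t ∈ Ico 0 L := hsub (Ico_subset_Icc_self ht)
    -- The flow at t is again exactly the background, so both layers are regular on some strip to
    -- the right and the energy estimate restarts from zero. The constants and the length of the
    -- strip may depend on t.
    obtain ⟨b₁, hb₁, κ₁, K₁, hr₁⟩ := h.upper.exists_isRegularLayer hφ hWp hg (hc cp) hlt1 htL htp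
    obtain ⟨b₂, hb₂, κ₂, K₂, hr₂⟩ := h.lower.exists_isRegularLayer hφ hWm (hc cm) hg hlt2 htL htm
    have hlt : t < min s (min b₁ b₂) := lt_min hs (lt_min hb₁.1 hb₂.1)
    obtain ⟨r, hr, hr'⟩ := exists_between hlt
    have hsubL : Ioo t (min b₁ b₂) ⊆ Ioo 0 L := fun y hy =>
      ⟨htL.1.trans_lt hy.1, hy.2.trans_le ((min_le_left _ _).trans hb₁.2)⟩
    refine ⟨r, ?_, hr, (hr'.trans_le (min_le_left _ _)).le⟩
    exact (hr₁.mono (min_le_left _ _)).isUniformSection (hr₂.mono (min_le_right _ _)) hWp hWm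
      (fun _ _ => deriv_const _ _) (fun _ _ => deriv_const _ _)
      (fun y hy => h.lower_wall y (hsubL hy)) (fun y hy => h.contact_lower y (hsubL hy))
      (fun y hy => h.contact_upper y (hsubL hy)) (fun y hy => h.upper_wall y (hsubL hy))
      (fun y hy => h.contact_pressure y (hsubL hy)) htp htm
      ⟨hr.le, hr'.trans_le (min_le_right _ _)⟩

theorem deriv_eq_zero_of_normalVelocity {u p ρ m : ℝ} (hu : u ≠ 0)
    (h : normalVelocity (uniformState u p ρ) m = 0) : m = 0 := by
  have hs : Real.sqrt (1 + m ^ 2) ≠ 0 := (Real.sqrt_pos.2 (by positivity)).ne'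
  rw [normalVelocity, div_eq_zero_iff, or_iff_left hs] at h
  simpa [uniformState, hu] using h

end CombustionNozzle

end
open CombustionNozzle in
theorem theorem1p3
    (G : Gas) (hφ : IsC11 G.φ)
    (L α : ℝ) (hL : 0 < L) (hα : α ∈ Set.Ioo (0 : ℝ) 1)
    -- the background state: `(u₊, 0, p₊, ρ₊, 0)` above and `(u₋, 0, p₋, ρ₋, 0)` below
    (up pp ρp um pm ρm : ℝ)
    (hρp : 0 < ρp) (hρm : 0 < ρm)
    (hlawp : G.StateLaw (uniformState up pp ρp)) (hlawm : G.StateLaw (uniformState um pm ρm))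
    (hup : G.sonic (uniformState up pp ρp) < up) (hum : G.sonic (uniformState um pm ρm) < um)
    (hp : pp = pm)
    -- the solution in the straight nozzle `(0, L) × (-1, 1)` with these entrance data
    (Um Up : ℝ × ℝ → FlowState) (gcd : ℝ → ℝ)
    (hsol : G.IsContactSolution α L (fun _ => -1) (fun _ => 1)
      (fun _ => uniformState um pm ρm) (fun _ => uniformState up pp ρp) Um Up gcd)
    (hgcd : IsC2Alpha α L gcd)
    (hUp : ∀ z ∈ region L gcd (fun _ => 1),
      0 < (Up z).u ∧ (Up z).u ≠ G.sonic (Up z) ∧ 0 < (Up z).ρ)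
    (hUm : ∀ z ∈ region L (fun _ => -1) gcd,
      0 < (Um z).u ∧ (Um z).u ≠ G.sonic (Um z) ∧ 0 < (Um z).ρ) :
    (∀ z ∈ region L gcd (fun _ => 1), Up z = uniformState up pp ρp) ∧
    (∀ z ∈ region L (fun _ => -1) gcd, Um z = uniformState um pm ρm) ∧
    (∀ x ∈ Set.Ico 0 L, gcd x = 0) := by
  subst hp
  have hWp := Gas.isSupersonic_uniformState hρp hlawp hup
  have hWm := Gas.isSupersonic_uniformState hρm hlawm hum
  have hcurve := hgcd.isCurve
  have hsec : ∀ x ∈ Set.Ico 0 L, _ := fun x hx =>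
    hsol.isUniformSection hL hφ.1.continuousOn hWp hWm hcurve hx
  refine ⟨fun z hz => ?_, fun z hz => ?_, fun x hx => ?_⟩
  · exact (hsec z.1 ⟨hz.1.le, hz.2.1⟩).1 z.2 ⟨hz.2.2.1.le, hz.2.2.2.le⟩
  · exact (hsec z.1 ⟨hz.1.le, hz.2.1⟩).2 z.2 ⟨hz.2.2.1.le, hz.2.2.2.le⟩
  · rcases hx.1.eq_or_lt with rfl | hx0
    · exact hsol.gcd_zero
    -- By the mean value theorem it suffices that the slope vanishes at an interior t. There the
    -- trace of `Up` is the background state, so the slip condition reduces to slope times a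
    -- positive velocity being zero.
    · obtain ⟨t, ht, hslope⟩ := exists_deriv_eq_slope gcd hx0
        (hcurve.cont.mono fun t ht => ⟨ht.1, ht.2.trans_lt hx.2⟩)
        fun t ht => (hcurve.diff t ⟨ht.1, ht.2.trans hx.2⟩).differentiableWithinAt
      have htL : t ∈ Set.Ioo 0 L := ⟨ht.1, ht.2.trans hx.2⟩
      have hslip := hsol.contact_upper t htL
      rw [(hsec t ⟨htL.1.le, htL.2⟩).1 (gcd t) ⟨le_rfl, (hsol.gcd_mem t ⟨htL.1.le, htL.2⟩).2.le⟩]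
        at hslip
      rw [deriv_eq_zero_of_normalVelocity hWp.u.ne' hslip, hsol.gcd_zero, sub_zero, sub_zero,
        eq_comm, div_eq_zero_iff] at hslope
      exact hslope.resolve_right hx0.ne'
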